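/- Let $n\ge 0$, $K\ge 1$, $A_0,\dots,A_K\in\mathbb R^{n\times n}$ and $0=\tau_0<\tau_1<\dots<\tau_K=:\tau$. Consider the delay equation $$\dot x(t)=\sum_{i=0}^K A_i\,x(t-\tau_i),\qquad t\ge 0 . \tag{1}$$ Put $I_i=[-\tau_i,-\tau_{i-1}]$ and $\Delta_i=\tau_i-\tau_{i-1}$ for $i=1,\dots,K$. A piecewise function on $[-\tau,0]$ is given by its pieces on the closed intervals $I_i$ (a kernel by its pieces on $I_i\times I_j$), so it may have two one-sided values at an interior delay point. Let $\mathbb S^m$ be the symmetric real $m\times m$ matrices and $\mathbb S^m_d[\theta]$ the symmetric $m\times m$ matrices of real polynomials in $\theta$ of degree at most $d$. **The sets $\tilde G_1^d,\tilde G_2^d,\tilde G_3^d$.** A function $M$ with pieces of size $2n$ (respectively $(K+2)n$) is in $\tilde G_1^d$ (respectively $\tilde G_3^d$) if there are $M_i\in\mathbb S_d^{2n}[\theta]$ and $T_i\in\mathbb S_d^n[\theta]$ (respectively $M_i\in\mathbb S_d^{(K+2)n}[\theta]$ and $T_i\in\mathbb S_d^{(K+1)n}[\theta]$), $i=1,\dots,K$,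 such that $M=M_i$ on $I_i$, $\sum_{i=1}^K\int_{I_i}T_i(\theta)\,d\theta=0$, and $$M_i(\theta)+\begin{pmatrix}T_i(\theta)&0\\0&0\end{pmatrix}\succeq 0\qquad\text{for all }\theta\in\mathbb R,\ i=1,\dots,K.$$ A kernel $N$ with $n\times n$ pieces $N_{ij}$ is in $\tilde G_2^d$ if there is a positive semidefinite matrix $U$ such that, with $m=\lfloor d/2\rfloor$, $Z(\theta)=I_{nK}\otimes(1,\theta,\dots,\theta^m)^T$ and $\bar R(\theta,\omega)=Z(\theta)^TU\,Z(\omega)$, partitioned into $n\times n$ blocks $\bar R_{ij}$, $i,j=1,\dots,K$, $$N_{ij}(\theta,\omega)=\bar R_{ij}\!\left(\tfrac{\tau}{\Delta_i}(\theta+\tau_{i-1}),\tfrac{\tau}{\Delta_j}(\omega+\tau_{j-1})\right)\qquad\text{for }\theta\in I_i,\ \omega\in I_j .$$ **Theorem.** Let $d\ge 0$ be an integer, $P\in\mathbb S^n$, $\eta>0$, and for $i,j=1,\dots,K$ let $Q_i:\mathbb R\to\mathbb R^{n\times n}$, $S_i:\mathbb R\to\mathbb S^n$ and $R_{ij}:\mathbb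 R^2\to\mathbb R^{n\times n}$ be continuous with $R_{ij}(\theta,\omega)=R_{ji}(\omega,\theta)^T$. Let $R$ be the kernel with pieces $R_{ij}$. Define $M$, $L$, $D$ for $\theta\in I_i$, $\omega\in I_j$ (derivatives are one-sided at end points) by $$M(\theta)=\begin{pmatrix}P-\eta I&\tau Q_i(\theta)\\ \tau Q_i(\theta)^T&\tau S_i(\theta)\end{pmatrix},\qquad L(\theta,\omega)=\frac{\partial}{\partial\theta}R_{ij}(\theta,\omega)+\frac{\partial}{\partial\omega}R_{ij}(\theta,\omega),$$ $$D(\theta)=\begin{pmatrix}D11&\tau\,D12_i(\theta)\\ \tau\,D12_i(\theta)^T&-\tau\,\dot S_i(\theta)\end{pmatrix}.$$ Here $D11$ is the symmetric $(K+1)\times(K+1)$ block matrix with $n\times n$ blocks $$D11_{11}=PA_0+A_0^TP+Q_1(0)+Q_1(0)^T+S_1(0)+\eta I,$$ $$D11_{1k}=D11_{k1}^T=PA_{k-1}-Q_{k-1}(-\tau_{k-1})+Q_k(-\tau_{k-1}),\qquad D11_{kk}=S_k(-\tau_{k-1})-S_{k-1}(-\tau_{k-1})\qquad(2\le k\le K),$$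 $$D11_{1,K+1}=D11_{K+1,1}^T=PA_K-Q_K(-\tau_K),\qquad D11_{K+1,K+1}=-S_K(-\tau_K),$$ and all other blocks $0$; and $D12_j(\theta)$ is the block column with the $n\times n$ blocks $$R_{1j}(0,\theta)+A_0^TQ_j(\theta)-\dot Q_j(\theta)\quad(\text{block }1),$$ $$R_{kj}(-\tau_{k-1},\theta)-R_{k-1,j}(-\tau_{k-1},\theta)+A_{k-1}^TQ_j(\theta)\quad(\text{block }k,\ 2\le k\le K),$$ $$A_K^TQ_j(\theta)-R_{Kj}(-\tau_K,\theta)\quad(\text{block }K+1).$$ If $$M\in\tilde G_1^d,\qquad R\in\tilde G_2^d,\qquad -D\in\tilde G_3^d,\qquad L\in\tilde G_2^d,$$ then the solution map of (1) is (globally) asymptotically stable: for every $\phi\in C([-\tau,0],\mathbb R^n)$ equation (1) has exactly one solution $x=G\phi\in C([-\tau,\infty),\mathbb R^n)$ with $x=\phi$ on $[-\tau,0]$ (with the right derivative at $t=0$); $G\phi$ is bounded and $G\phi(t)\to0$ as $t\to\infty$; and for every $\varepsilon>0$ there is $\delta>0$ such that $\sup_{\theta\in[-\tau,0]}\|\phi(\theta)\|<\delta$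 implies $\|G\phi(t)\|<\varepsilon$ for all $t\ge-\tau$. -/

import Mathlib

open Set Filter Topology
open scoped NNReal

noncomputable section

namespace TimeDelay

/-! ## Functional differential equations and stability -/

/-- The state space `C([-r, 0], ℝⁿ)`, with the norm `sup ‖u θ‖₂`. -/
abbrev State (r : ℝ) (n : ℕ) : Type := C(Icc (-r) (0 : ℝ), EuclideanSpace ℝ (Fin n))

/-- The trajectory space `C([-r, ∞), ℝⁿ)`. -/
abbrev Trajectory (r : ℝ) (n : ℕ) : Type := C(Ici (-r), EuclideanSpace ℝ (Fin n))

/-- The segment `x_t(θ) = x(t + θ)`, `θ ∈ [-r, 0]`, of a trajectory at time `t ≥ 0`. -/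
def segment {r : ℝ} {n : ℕ} (x : Trajectory r n) (t : ℝ≥0) : State r n where
  toFun θ := x ⟨t + θ, by
    have h1 := θ.2.1
    have h2 := t.2
    simp only [mem_Ici]
    linarith⟩
  continuous_toFun := by fun_prop

/-- `x` solves `ẋ(t) = f(x_t)` for `t ≥ 0` (one-sided derivative at `t = 0`), with initial
condition `φ` on `[-r, 0]`. -/
def IsSolution {r : ℝ} {n : ℕ} (f : State r n → EuclideanSpace ℝ (Fin n))
    (φ : State r n) (x : Trajectory r n) : Prop :=
  (∀ (θ : ℝ) (hθ : θ ∈ Icc (-r) (0 : ℝ)), x ⟨θ, hθ.1⟩ = φ ⟨θ, hθ⟩) ∧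
  ∀ t : ℝ≥0, HasDerivWithinAt (IciExtend (x : Ici (-r) → EuclideanSpace ℝ (Fin n)))
    (f (segment x t)) (Ici 0) (t : ℝ)

/-- `G` is the solution map of `ẋ(t) = f(x_t)`: for every initial condition `φ` there is exactly
one solution, and it is `G φ`. -/
def IsSolutionMap {r : ℝ} {n : ℕ} (f : State r n → EuclideanSpace ℝ (Fin n))
    (G : State r n → Trajectory r n) : Prop :=
  ∀ φ x, IsSolution f φ x ↔ x = G φ

/-- Stability on `X`: solutions starting in `X` are bounded, and `G` is continuous at `0` for the
supremum norms. -/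
def IsStableOn {r : ℝ} {n : ℕ} (G : State r n → Trajectory r n) (X : Set (State r n)) : Prop :=
  (∀ φ ∈ X, ∃ b : ℝ, ∀ t, ‖G φ t‖ ≤ b) ∧
  ∀ ε > 0, ∃ δ > 0, ∀ φ : State r n, ‖φ‖ < δ → ∀ t, ‖G φ t‖ < ε

/-- Asymptotic stability on `X`: stability, and convergence to `0` of the solutions that start
in `X`. -/
def IsAsymptoticallyStableOn {r : ℝ} {n : ℕ} (G : State r n → Trajectory r n)
    (X : Set (State r n)) : Prop :=
  IsStableOn G X ∧
  ∀ φ ∈ X, Tendsto (IciExtend (G φ : Ici (-r) → EuclideanSpace ℝ (Fin n))) atTop (𝓝 0)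

/-! ## Linear systems with several delays -/

/-- Delays `0 = τ₀ < τ₁ < ⋯ < τ_K`. -/
structure Delays (K : ℕ) where
  val : Fin (K + 1) → ℝ
  val_zero : val 0 = 0
  strictMono : StrictMono val

namespace Delays

variable {K : ℕ} (τ : Delays K)

/-- The largest delay `τ_K`. -/
def last : ℝ := τ.val (Fin.last K)

theorem neg_mem (k : Fin (K + 1)) : -τ.val k ∈ Icc (-τ.last) (0 : ℝ) := by
  constructor
  · exact neg_le_neg (τ.strictMono.monotone (Fin.le_last k))
  · have h := τ.strictMono.monotone (Fin.zero_le k)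
    rw [τ.val_zero] at h
    linarith

/-- The `K` intervals `[-τ_i, -τ_{i-1}]`, `i = 1, …, K`; here and below the index `i : Fin K`
stands for `i + 1`. -/
def interval (i : Fin K) : Set ℝ := Icc (-τ.val i.succ) (-τ.val i.castSucc)

/-- The length `Δ_i = τ_i - τ_{i-1}`. -/
def width (i : Fin K) : ℝ := τ.val i.succ - τ.val i.castSucc

/-- The affine map of the `i`-th interval onto `[-τ_K, 0]`. -/
def rescale (i : Fin K) (θ : ℝ) : ℝ :=
  τ.last / τ.width i * θ + τ.val i.castSucc * (τ.last / τ.width i)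

end Delays

/-- The functional `φ ↦ ∑_{k=0}^K A_k φ(-τ_k)`, whose equation is
`ẋ(t) = ∑_{k=0}^K A_k x(t - τ_k)`. -/
def delayFunctional {K n : ℕ} (τ : Delays K) (A : Fin (K + 1) → Matrix (Fin n) (Fin n) ℝ)
    (φ : State τ.last n) : EuclideanSpace ℝ (Fin n) :=
  ∑ k, Matrix.toEuclideanLin (A k) (φ ⟨-τ.val k, τ.neg_mem k⟩)

/-! ## Positivity conditions

A piecewise function is the family of its pieces: the piece with index `i` is only looked at on the
`i`-th interval, so that it may have two different one-sided values at an interior delay point. -/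

/-- The value of a polynomial matrix at `θ`. -/
def evalAt {ι : Type*} (A : Matrix ι ι (Polynomial ℝ)) (θ : ℝ) : Matrix ι ι ℝ :=
  A.map (Polynomial.eval θ)

/-- Symmetric polynomial matrices of degree at most `d`. -/
def IsSymPoly {ι : Type*} (d : ℕ) (A : Matrix ι ι (Polynomial ℝ)) : Prop :=
  A.IsSymm ∧ ∀ a b, (A a b).natDegree ≤ d

/-- Piecewise polynomial spacing functions: symmetric pieces of degree at most `d` whose
integrals over the intervals add up to zero. -/
def IsSpacing {K : ℕ} {ι : Type*} (τ : Delays K) (d : ℕ)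
    (T : Fin K → Matrix ι ι (Polynomial ℝ)) : Prop :=
  (∀ i, IsSymPoly d (T i)) ∧
  ∀ a b, ∑ i, ∫ θ in (-τ.val i.succ)..(-τ.val i.castSucc), (T i a b).eval θ = 0

/-- `M` is given on the intervals by symmetric polynomial matrices of degree at most `d`, which
become positive semidefinite on all of `ℝ` when a spacing function is added to the upper left
block. -/
def IsPosUpToSpacing {K : ℕ} {α β : Type*} (τ : Delays K) (d : ℕ)
    (M : Fin K → ℝ → Matrix (α ⊕ β) (α ⊕ β) ℝ) : Prop :=
  ∃ (N : Fin K → Matrix (α ⊕ β) (α ⊕ β) (Polynomial ℝ)) (T : Fin K → Matrix α α (Polynomial ℝ)),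
    (∀ i, IsSymPoly d (N i)) ∧ (∀ i, ∀ θ ∈ τ.interval i, M i θ = evalAt (N i) θ) ∧
    IsSpacing τ d T ∧
    ∀ i θ, (evalAt (N i) θ + Matrix.fromBlocks (evalAt (T i) θ) 0 0 0).PosSemidef

/-- The set `G̃₁ᵈ`. -/
def G1 {K n : ℕ} (τ : Delays K) (d : ℕ) :
    Set (Fin K → ℝ → Matrix (Fin n ⊕ Fin n) (Fin n ⊕ Fin n) ℝ) :=
  {M | IsPosUpToSpacing τ d M}

/-- The set `G̃₃ᵈ`; the upper left block consists of `K + 1` blocks of size `n`. -/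
def G3 {K n : ℕ} (τ : Delays K) (d : ℕ) :
    Set (Fin K → ℝ → Matrix ((Fin (K + 1) × Fin n) ⊕ Fin n) ((Fin (K + 1) × Fin n) ⊕ Fin n) ℝ) :=
  {M | IsPosUpToSpacing τ d M}

/-- The kernels `Z(θ)ᵀ U Z(ω)` with `U` positive semidefinite and `Z(θ) = I ⊗ (1, θ, …, θᵐ)ᵀ`,
where `m = ⌊d / 2⌋`. -/
def PosKernel {ι : Type*} (d : ℕ) : Set (ℝ → ℝ → Matrix ι ι ℝ) :=
  {R | ∃ U : Matrix (ι × Fin (d / 2 + 1)) (ι × Fin (d / 2 + 1)) ℝ, U.PosSemidef ∧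
    ∀ θ ω a b, R θ ω a b =
      ∑ k : Fin (d / 2 + 1), ∑ l : Fin (d / 2 + 1), θ ^ (k : ℕ) * U (a, k) (b, l) * ω ^ (l : ℕ)}

/-- The set `G̃₂ᵈ` of piecewise kernels, obtained by rescaling the blocks of an element of
`PosKernel d` of size `nK`. -/
def G2 {K n : ℕ} (τ : Delays K) (d : ℕ) :
    Set (Fin K → Fin K → ℝ → ℝ → Matrix (Fin n) (Fin n) ℝ) :=
  {N | ∃ R ∈ PosKernel (ι := Fin K × Fin n) d,
    ∀ i j, ∀ θ ∈ τ.interval i, ∀ ω ∈ τ.interval j, ∀ a b,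
      N i j θ ω a b = R (τ.rescale i θ) (τ.rescale j ω) (i, a) (j, b)}

/-! ## The matrices of the stability test -/

/-- Entrywise derivative of the piece of index `i` on its interval (one-sided at the end points). -/
def pieceDeriv {K n : ℕ} (τ : Delays K) (i : Fin K) (F : ℝ → Matrix (Fin n) (Fin n) ℝ) (θ : ℝ) :
    Matrix (Fin n) (Fin n) ℝ :=
  Matrix.of fun a b => derivWithin (fun s => F s a b) (τ.interval i) θ

/-- The jump `F_{k+1}(-τ_k) - F_k(-τ_k)` of a piecewise function at `-τ_k`, where `F_0` and
`F_{K+1}` count as zero: it is `F_1(0)` for `k = 0` and `-F_K(-τ_K)` for `k = K`. -/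
def jump {K n : ℕ} (τ : Delays K) (F : Fin K → ℝ → Matrix (Fin n) (Fin n) ℝ) (k : Fin (K + 1)) :
    Matrix (Fin n) (Fin n) ℝ :=
  (if h : (k : ℕ) < K then F ⟨k, h⟩ (-τ.val k) else 0) -
    (if h : 0 < (k : ℕ) then F ⟨k - 1, by have := k.2; omega⟩ (-τ.val k) else 0)

/-- The pieces of `M`. -/
def lyapM {K n : ℕ} (τ : Delays K) (P : Matrix (Fin n) (Fin n) ℝ) (η : ℝ)
    (Q S : Fin K → ℝ → Matrix (Fin n) (Fin n) ℝ) (i : Fin K) (θ : ℝ) :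
    Matrix (Fin n ⊕ Fin n) (Fin n ⊕ Fin n) ℝ :=
  Matrix.fromBlocks (P - η • 1) (τ.last • Q i θ) (τ.last • (Q i θ).transpose) (τ.last • S i θ)

/-- The pieces of `L = ∂R/∂θ + ∂R/∂ω`. -/
def lyapL {K n : ℕ} (τ : Delays K) (R : Fin K → Fin K → ℝ → ℝ → Matrix (Fin n) (Fin n) ℝ)
    (i j : Fin K) (θ ω : ℝ) : Matrix (Fin n) (Fin n) ℝ :=
  pieceDeriv τ i (fun s => R i j s ω) θ + pieceDeriv τ j (fun s => R i j θ s) ω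

/-- The `n × n` blocks of `D11`, for `k, l = 0, …, K`. -/
def blockD11 {K n : ℕ} (τ : Delays K) (A : Fin (K + 1) → Matrix (Fin n) (Fin n) ℝ)
    (P : Matrix (Fin n) (Fin n) ℝ) (η : ℝ) (Q S : Fin K → ℝ → Matrix (Fin n) (Fin n) ℝ)
    (k l : Fin (K + 1)) : Matrix (Fin n) (Fin n) ℝ :=
  if k = 0 then
    if l = 0 then
      P * A 0 + (A 0).transpose * P + jump τ Q 0 + (jump τ Q 0).transpose + jump τ S 0 + η • 1
    else P * A l + jump τ Q l
  else
    if l = 0 then (P * A k + jump τ Q k).transpose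
    else if k = l then jump τ S k
    else 0

/-- The blocks of `D12_j(θ)`, for `k = 0, …, K`. -/
def blockD12 {K n : ℕ} (τ : Delays K) (A : Fin (K + 1) → Matrix (Fin n) (Fin n) ℝ)
    (Q : Fin K → ℝ → Matrix (Fin n) (Fin n) ℝ)
    (R : Fin K → Fin K → ℝ → ℝ → Matrix (Fin n) (Fin n) ℝ)
    (j : Fin K) (θ : ℝ) (k : Fin (K + 1)) : Matrix (Fin n) (Fin n) ℝ :=
  jump τ (fun i s => R i j s θ) k + (A k).transpose * Q j θ -
    (if k = 0 then pieceDeriv τ j (Q j) θ else 0)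

/-- The pieces of `D`. -/
def lyapD {K n : ℕ} (τ : Delays K) (A : Fin (K + 1) → Matrix (Fin n) (Fin n) ℝ)
    (P : Matrix (Fin n) (Fin n) ℝ) (η : ℝ) (Q S : Fin K → ℝ → Matrix (Fin n) (Fin n) ℝ)
    (R : Fin K → Fin K → ℝ → ℝ → Matrix (Fin n) (Fin n) ℝ) (j : Fin K) (θ : ℝ) :
    Matrix ((Fin (K + 1) × Fin n) ⊕ Fin n) ((Fin (K + 1) × Fin n) ⊕ Fin n) ℝ :=
  let D12 : Matrix (Fin (K + 1) × Fin n) (Fin n) ℝ :=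
    Matrix.of fun p b => blockD12 τ A Q R j θ p.1 p.2 b
  Matrix.fromBlocks
    (Matrix.of fun p q => blockD11 τ A P η Q S p.1 q.1 p.2 q.2)
    (τ.last • D12) (τ.last • D12.transpose) (τ.last • -pieceDeriv τ j (S j) θ)

end TimeDelay

end

namespace TimeDelay

open scoped Matrix

/-! ## Integrals over a moving window -/

/-! The proof uses a complete quadratic Lyapunov–Krasovskii functional, V = xᵀPx + 2xᵀ∫Q(θ)x(t+θ)dθ
+ ∫x(t+θ)ᵀS(θ)x(t+θ)dθ + ∬x(t+θ)ᵀR(θ,ω)x(t+ω)dωdθ. Since `R` lies in `G2`, it is separable and its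
double integral is a form mᵀUm in finitely many moments m of x; `lyapV` uses that form directly.

A spacing function acts only on the component that is constant in θ, so it integrates to zero. Hence
membership in `G1` or `G3` makes the integral of the corresponding quadratic form nonnegative
(`IsPosUpToSpacing.pieceIntegral_nonneg`). For M, together with U ⪰ 0, this gives V ≥ η|x|²
(`le_lyapV`). Along a solution, summation by parts over the delay points turns the boundary terms of
V' into the jumps stored in D. What remains is the double integral of -L, which equals -mᵀWm ≤ 0.
The term ηI in D11 then leaves V' ≤ -η|x|² (`deriv_lyapV_le`).

Integrating gives η|x(t)|² + η∫₀ᵗ|x|² ≤ V(0) (`exists_energy_bound`), where V(0) is continuous in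
the initial function and vanishes at 0. This one estimate yields boundedness, stability and, applied
to a difference of two solutions, uniqueness. It also makes |x|² and its derivative integrable, so x
→ 0 (`tendsto_zero_of_integral_sq_le`). Existence is separate: a contraction in an exponentially
weighted norm (`exists_delay_solution`). -/

theorem hasDerivAt_integral_mul_shift {p p' f : ℝ → ℝ} (hp : ∀ θ, HasDerivAt p (p' θ) θ)
    (hp' : Continuous p') (hf : Continuous f) (a b t : ℝ) :
    HasDerivAt (fun t => ∫ θ in a..b, p θ * f (t + θ))
      (p b * f (t + b) - p a * f (t + a) - ∫ θ in a..b, p' θ * f (t + θ)) t := by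
  -- `f` is only continuous, so one cannot differentiate under the integral directly. Integration by
  -- parts replaces `f` by its primitive `F`, whose translates are C¹ in t.
  set F : ℝ → ℝ := fun t => ∫ s in (0 : ℝ)..t, f s with hF
  have hFd : ∀ t, HasDerivAt F (f t) t := fun t =>
    intervalIntegral.integral_hasDerivAt_right (hf.intervalIntegrable _ _)
      (hf.stronglyMeasurableAtFilter _ _) hf.continuousAt
  have hFc : Continuous F := continuous_iff_continuousAt.2 fun t => (hFd t).continuousAt
  have key : ∀ t, ∫ θ in a..b, p θ * f (t + θ) =
      p b * F (t + b) - p a * F (t + a) - ∫ θ in a..b, p' θ * F (t + θ) := by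
    intro t
    refine intervalIntegral.integral_mul_deriv_eq_deriv_mul (v := fun θ => F (t + θ))
      (fun θ _ => hp θ) (fun θ _ => ?_) (hp'.intervalIntegrable _ _)
      (Continuous.intervalIntegrable (by fun_prop) _ _)
    exact (hFd (t + θ)).comp_const_add t θ
  simp_rw [key]
  refine HasDerivAt.sub (HasDerivAt.sub ?_ ?_) ?_
  · exact ((hFd (t + b)).comp_add_const t b).const_mul _
  · exact ((hFd (t + a)).comp_add_const t a).const_mul _
  -- A bound for the t-derivative of the integrand on a compact neighbourhood of t serves as the
  -- dominating constant.
  · obtain ⟨C, hC⟩ := ((isCompact_Icc (a := t - 1) (b := t + 1)).prod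
      (isCompact_uIcc (a := a) (b := b))).exists_bound_of_continuousOn
      (f := fun q : ℝ × ℝ => p' q.2 * f (q.1 + q.2)) (by fun_prop)
    refine (intervalIntegral.hasDerivAt_integral_of_dominated_loc_of_deriv_le
      (F := fun t θ => p' θ * F (t + θ)) (F' := fun t θ => p' θ * f (t + θ))
      (s := Icc (t - 1) (t + 1)) (bound := fun _ => C) (Icc_mem_nhds (by linarith) (by linarith))
      (Eventually.of_forall fun s => (Continuous.aestronglyMeasurable (by fun_prop)))
      (Continuous.intervalIntegrable (by fun_prop) _ _)
      (Continuous.aestronglyMeasurable (by fun_prop)) ?_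
      intervalIntegrable_const ?_).2
    · exact Eventually.of_forall fun θ hθ s hs => hC (s, θ) ⟨hs, uIoc_subset_uIcc hθ⟩
    · exact Eventually.of_forall fun θ _ s _ => ((hFd (s + θ)).comp_add_const s θ).const_mul _

theorem hasDerivAt_integral_sum_mul_shift {ι : Type*} [Fintype ι] {p p' f : ι → ℝ → ℝ}
    (hp : ∀ c θ, HasDerivAt (p c) (p' c θ) θ) (hp' : ∀ c, Continuous (p' c))
    (hf : ∀ c, Continuous (f c)) (a b t : ℝ) :
    HasDerivAt (fun t => ∫ θ in a..b, ∑ c, p c θ * f c (t + θ))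
      (∑ c, p c b * f c (t + b) - ∑ c, p c a * f c (t + a) -
        ∫ θ in a..b, ∑ c, p' c θ * f c (t + θ)) t := by
  have hpc : ∀ c, Continuous (p c) := fun c =>
    continuous_iff_continuousAt.2 fun t => (hp c t).continuousAt
  have e1 : ∀ t, ∫ θ in a..b, ∑ c, p c θ * f c (t + θ) =
      ∑ c, ∫ θ in a..b, p c θ * f c (t + θ) := fun t =>
    intervalIntegral.integral_finsetSum fun c _ =>
      Continuous.intervalIntegrable (by fun_prop) _ _
  have e2 : ∫ θ in a..b, ∑ c, p' c θ * f c (t + θ) =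
      ∑ c, ∫ θ in a..b, p' c θ * f c (t + θ) :=
    intervalIntegral.integral_finsetSum fun c _ =>
      Continuous.intervalIntegrable (by fun_prop) _ _
  simp_rw [e1, e2, ← Finset.sum_sub_distrib]
  exact HasDerivAt.fun_sum fun c _ => hasDerivAt_integral_mul_shift (hp c) (hp' c) (hf c) a b t

/-! ## Piecewise functions -/

section Pieces

variable {K : ℕ} (τ : Delays K)

theorem Delays.left_lt_right (i : Fin K) : -τ.val i.succ < -τ.val i.castSucc :=
  neg_lt_neg (τ.strictMono i.castSucc_lt_succ)

theorem Delays.left_mem (i : Fin K) : -τ.val i.succ ∈ τ.interval i :=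
  left_mem_Icc.2 (τ.left_lt_right i).le

theorem Delays.right_mem (i : Fin K) : -τ.val i.castSucc ∈ τ.interval i :=
  right_mem_Icc.2 (τ.left_lt_right i).le

theorem Delays.uIcc_eq (i : Fin K) : uIcc (-τ.val i.succ) (-τ.val i.castSucc) = τ.interval i :=
  uIcc_of_le (τ.left_lt_right i).le

theorem Delays.last_pos (hK : 1 ≤ K) : 0 < τ.last := by
  rw [← τ.val_zero]
  apply τ.strictMono
  rw [Fin.lt_def]
  simpa using Nat.lt_of_lt_of_le one_pos hK

theorem Delays.sum_width : ∑ i, τ.width i = τ.last := by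
  have h1 := Fin.sum_univ_succ (fun k => τ.val k)
  have h2 := Fin.sum_univ_castSucc (fun k => τ.val k)
  rw [τ.val_zero] at h1
  simp only [Delays.width, Finset.sum_sub_distrib, Delays.last]
  linarith

theorem Delays.interval_subset (i : Fin K) : τ.interval i ⊆ Icc (-τ.last) 0 :=
  Icc_subset_Icc (τ.neg_mem _).1 (τ.neg_mem _).2

/-- The integral of a piecewise function over `[-τ_K, 0]`. -/
noncomputable def pieceIntegral (f : Fin K → ℝ → ℝ) : ℝ :=
  ∑ i, ∫ θ in (-τ.val i.succ)..(-τ.val i.castSucc), f i θ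

variable {τ}

theorem pieceIntegral_congr {f g : Fin K → ℝ → ℝ} (h : ∀ i, ∀ θ ∈ τ.interval i, f i θ = g i θ) :
    pieceIntegral τ f = pieceIntegral τ g :=
  Finset.sum_congr rfl fun i _ =>
    intervalIntegral.integral_congr fun θ hθ => h i θ (τ.uIcc_eq i ▸ hθ)

theorem pieceIntegral_add {f g : Fin K → ℝ → ℝ} (hf : ∀ i, Continuous (f i))
    (hg : ∀ i, Continuous (g i)) :
    pieceIntegral τ (fun i θ => f i θ + g i θ) = pieceIntegral τ f + pieceIntegral τ g := by
  simp only [pieceIntegral, ← Finset.sum_add_distrib]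
  exact Finset.sum_congr rfl fun i _ => intervalIntegral.integral_add
    ((hf i).intervalIntegrable _ _) ((hg i).intervalIntegrable _ _)

theorem pieceIntegral_sum {ι : Type*} (s : Finset ι) {f : ι → Fin K → ℝ → ℝ}
    (hf : ∀ c i, Continuous (f c i)) :
    pieceIntegral τ (fun i θ => ∑ c ∈ s, f c i θ) = ∑ c ∈ s, pieceIntegral τ (f c) := by
  simp only [pieceIntegral]
  rw [Finset.sum_comm]
  exact Finset.sum_congr rfl fun i _ => intervalIntegral.integral_finsetSum
    fun c _ => (hf c i).intervalIntegrable _ _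

theorem pieceIntegral_const_mul (c : ℝ) (f : Fin K → ℝ → ℝ) :
    pieceIntegral τ (fun i θ => c * f i θ) = c * pieceIntegral τ f := by
  simp only [pieceIntegral, Finset.mul_sum, intervalIntegral.integral_const_mul]

theorem pieceIntegral_const (c : ℝ) : pieceIntegral τ (fun _ _ => c) = τ.last * c := by
  simp only [pieceIntegral, intervalIntegral.integral_const, smul_eq_mul, ← Finset.sum_mul]
  rw [← τ.sum_width]
  congr 1
  exact Finset.sum_congr rfl fun i _ => by simp only [Delays.width]; ring

theorem pieceIntegral_nonneg {f : Fin K → ℝ → ℝ} (h : ∀ i θ, 0 ≤ f i θ) :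
    0 ≤ pieceIntegral τ f :=
  Finset.sum_nonneg fun i _ =>
    intervalIntegral.integral_nonneg (τ.left_lt_right i).le fun θ _ => h i θ

/-- Summation by parts for the jumps. -/
theorem sum_jump {n : ℕ} (F : Fin K → ℝ → Matrix (Fin n) (Fin n) ℝ)
    (φ : Fin (K + 1) → Matrix (Fin n) (Fin n) ℝ →+ ℝ) :
    ∑ k, φ k (jump τ F k) =
      ∑ i : Fin K, (φ i.castSucc (F i (-τ.val i.castSucc)) - φ i.succ (F i (-τ.val i.succ))) := by
  simp only [jump, map_sub, Finset.sum_sub_distrib]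
  congr 1
  · rw [Fin.sum_univ_castSucc]
    simp
  · rw [Fin.sum_univ_succ]
    simp

end Pieces

theorem continuous_evalAt {ι : Type*} (A : Matrix ι ι (Polynomial ℝ)) (a b : ι) :
    Continuous fun θ => evalAt A θ a b := by
  simp only [evalAt, Matrix.map_apply]
  exact (A a b).continuous

theorem sumElim_quadForm {α β : Type*} [Fintype α] [Fintype β] (A : Matrix α α ℝ)
    (B : Matrix α β ℝ) (C : Matrix β α ℝ) (D : Matrix β β ℝ) (y : α → ℝ) (z : β → ℝ) :
    Sum.elim y z ⬝ᵥ (Matrix.fromBlocks A B C D).mulVec (Sum.elim y z) =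
      y ⬝ᵥ A.mulVec y + y ⬝ᵥ B.mulVec z + z ⬝ᵥ C.mulVec y + z ⬝ᵥ D.mulVec z := by
  rw [Matrix.fromBlocks_mulVec, sumElim_dotProduct_sumElim]
  simp only [Sum.elim_comp_inl, Sum.elim_comp_inr, dotProduct_add]
  ring

/-- A piecewise matrix that is positive up to a spacing function has a nonnegative quadratic
integral on the functions with constant first component. -/
theorem IsPosUpToSpacing.pieceIntegral_nonneg {K : ℕ} {τ : Delays K} {α β : Type*} [Fintype α]
    [Fintype β] {d : ℕ} {M : Fin K → ℝ → Matrix (α ⊕ β) (α ⊕ β) ℝ} (h : IsPosUpToSpacing τ d M)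
    (y : α → ℝ) {z : ℝ → β → ℝ} (hz : Continuous z) :
    0 ≤ pieceIntegral τ fun i θ => Sum.elim y (z θ) ⬝ᵥ (M i θ).mulVec (Sum.elim y (z θ)) := by
  obtain ⟨N, T, -, hMN, hT, hpos⟩ := h
  have hc : ∀ c, Continuous fun θ => Sum.elim y (z θ) c := by
    rintro (c | c)
    · exact continuous_const
    · exact (continuous_apply c).comp hz
  have cT := fun i a b => continuous_evalAt (T i) a b
  have cN := fun i a b => continuous_evalAt (N i) a b
  -- Because `y` does not depend on θ, the products `y a * y b` leave the integral, and the entries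
  -- of the spacing function integrate to zero.
  have h0 : pieceIntegral τ (fun i θ => y ⬝ᵥ (evalAt (T i) θ).mulVec y) = 0 := by
    have : (fun (i : Fin K) θ => y ⬝ᵥ (evalAt (T i) θ).mulVec y) =
        fun i θ => ∑ a, ∑ b, (y a * y b) * evalAt (T i) θ a b := by
      ext i θ
      simp only [dotProduct, Matrix.mulVec, Finset.mul_sum]
      exact Finset.sum_congr rfl fun a _ => Finset.sum_congr rfl fun b _ => by ring
    rw [this, pieceIntegral_sum _ (fun a i => by fun_prop)]
    refine Finset.sum_eq_zero fun a _ => ?_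
    rw [pieceIntegral_sum _ (fun a i => by fun_prop)]
    refine Finset.sum_eq_zero fun b _ => ?_
    rw [pieceIntegral_const_mul]
    have := hT.2 a b
    simp only [pieceIntegral, evalAt, Matrix.map_apply, this, mul_zero]
  have hq : ∀ i, Continuous fun θ =>
      Sum.elim y (z θ) ⬝ᵥ (evalAt (N i) θ).mulVec (Sum.elim y (z θ)) := fun i => by
    simp only [dotProduct, Matrix.mulVec]
    fun_prop
  have key : pieceIntegral τ (fun i θ => Sum.elim y (z θ) ⬝ᵥ (M i θ).mulVec (Sum.elim y (z θ))) =
      pieceIntegral τ (fun i θ => Sum.elim y (z θ) ⬝ᵥ (evalAt (N i) θ).mulVec (Sum.elim y (z θ)) +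
        y ⬝ᵥ (evalAt (T i) θ).mulVec y) := by
    rw [pieceIntegral_add hq fun i => by simp only [dotProduct, Matrix.mulVec]; fun_prop, h0,
      add_zero]
    exact pieceIntegral_congr fun i θ hθ => by rw [hMN i θ hθ]
  rw [key]
  refine TimeDelay.pieceIntegral_nonneg fun i θ => ?_
  have := (hpos i θ).dotProduct_mulVec_nonneg (Sum.elim y (z θ))
  rw [star_trivial, Matrix.add_mulVec, dotProduct_add, sumElim_quadForm (evalAt (T i) θ)] at this
  simpa using this

/-! ### The quadratic functional and its derivative along a trajectory -/

section Functional

variable {K n m : ℕ} (τ : Delays K)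

/-- `∫ F(θ) x(t + θ) dθ` over `[-τ_K, 0]`. -/
noncomputable def windowVec (F : Fin K → ℝ → Matrix (Fin n) (Fin n) ℝ) (x : ℝ → Fin n → ℝ) (t : ℝ)
    (a : Fin n) : ℝ :=
  pieceIntegral τ fun i θ => (F i θ *ᵥ x (t + θ)) a

/-- `∫ x(t + θ)ᵀ F(θ) x(t + θ) dθ` over `[-τ_K, 0]`. -/
noncomputable def windowQuad (F : Fin K → ℝ → Matrix (Fin n) (Fin n) ℝ) (x : ℝ → Fin n → ℝ)
    (t : ℝ) : ℝ :=
  pieceIntegral τ fun i θ => x (t + θ) ⬝ᵥ F i θ *ᵥ x (t + θ)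

/-- The moments `∫ p_{ik}(θ) x_a(t + θ) dθ` over the `i`-th interval. -/
noncomputable def moment (p : Fin K → Fin m → ℝ → ℝ) (x : ℝ → Fin n → ℝ) (t : ℝ)
    (c : (Fin K × Fin n) × Fin m) : ℝ :=
  ∫ θ in (-τ.val c.1.1.succ)..(-τ.val c.1.1.castSucc), p c.1.1 c.2 θ * x (t + θ) c.1.2

/-- The value on the `j`-th interval of the row vector function `∑_l v_{jbl} p_{jl}(θ)`. -/
noncomputable def rowEval (p : Fin K → Fin m → ℝ → ℝ) (v : (Fin K × Fin n) × Fin m → ℝ)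
    (j : Fin K) (θ : ℝ) (b : Fin n) : ℝ :=
  ∑ l, v ((j, b), l) * p j l θ

/-- The complete quadratic functional along a trajectory. -/
noncomputable def lyapV (P : Matrix (Fin n) (Fin n) ℝ) (F G : Fin K → ℝ → Matrix (Fin n) (Fin n) ℝ)
    (p : Fin K → Fin m → ℝ → ℝ)
    (U : Matrix ((Fin K × Fin n) × Fin m) ((Fin K × Fin n) × Fin m) ℝ)
    (x : ℝ → Fin n → ℝ) (t : ℝ) : ℝ :=
  x t ⬝ᵥ P *ᵥ x t + 2 * (x t ⬝ᵥ windowVec τ F x t) + windowQuad τ G x t +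
    moment τ p x t ⬝ᵥ U *ᵥ moment τ p x t

/-- The boundary term `∑_i (F_i(-τ_{i-1}) x(t - τ_{i-1}) - F_i(-τ_i) x(t - τ_i))`. -/
def boundaryVec (F : Fin K → ℝ → Matrix (Fin n) (Fin n) ℝ) (x : ℝ → Fin n → ℝ) (t : ℝ) :
    Fin n → ℝ :=
  ∑ i : Fin K, (F i (-τ.val i.castSucc) *ᵥ x (t + -τ.val i.castSucc) -
    F i (-τ.val i.succ) *ᵥ x (t + -τ.val i.succ))

/-- The quadratic boundary term of the functional. -/
def boundaryQuad (F : Fin K → ℝ → Matrix (Fin n) (Fin n) ℝ) (x : ℝ → Fin n → ℝ) (t : ℝ) : ℝ :=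
  ∑ i : Fin K, (x (t + -τ.val i.castSucc) ⬝ᵥ F i (-τ.val i.castSucc) *ᵥ x (t + -τ.val i.castSucc) -
    x (t + -τ.val i.succ) ⬝ᵥ F i (-τ.val i.succ) *ᵥ x (t + -τ.val i.succ))

/-- The boundary terms of the moments. -/
def boundaryMoment (p : Fin K → Fin m → ℝ → ℝ) (x : ℝ → Fin n → ℝ) (t : ℝ)
    (c : (Fin K × Fin n) × Fin m) : ℝ :=
  p c.1.1 c.2 (-τ.val c.1.1.castSucc) * x (t + -τ.val c.1.1.castSucc) c.1.2 -
    p c.1.1 c.2 (-τ.val c.1.1.succ) * x (t + -τ.val c.1.1.succ) c.1.2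

variable {τ}

theorem hasDerivAt_windowVec {F F' : Fin K → ℝ → Matrix (Fin n) (Fin n) ℝ} {x : ℝ → Fin n → ℝ}
    (hF : ∀ i a b θ, HasDerivAt (fun θ => F i θ a b) (F' i θ a b) θ)
    (hF' : ∀ i a b, Continuous fun θ => F' i θ a b) (hx : Continuous x) (t : ℝ) :
    HasDerivAt (windowVec τ F x) (boundaryVec τ F x t - windowVec τ F' x t) t := by
  refine hasDerivAt_pi.2 fun a => ?_
  simp only [boundaryVec, windowVec, pieceIntegral, Pi.sub_apply, Finset.sum_apply,
    ← Finset.sum_sub_distrib]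
  exact HasDerivAt.fun_sum fun i _ =>
    hasDerivAt_integral_sum_mul_shift (f := fun b s => x s b) (fun b θ => hF i a b θ)
      (fun b => hF' i a b) (fun b => (continuous_apply b).comp hx) _ _ t

theorem quadForm_eq_sum (B : Matrix (Fin n) (Fin n) ℝ) (v : Fin n → ℝ) :
    v ⬝ᵥ B *ᵥ v = ∑ c : Fin n × Fin n, B c.1 c.2 * (v c.1 * v c.2) := by
  simp only [dotProduct, Matrix.mulVec, Finset.mul_sum, Fintype.sum_prod_type]
  exact Finset.sum_congr rfl fun a _ => Finset.sum_congr rfl fun b _ => by ring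

theorem hasDerivAt_windowQuad {F F' : Fin K → ℝ → Matrix (Fin n) (Fin n) ℝ} {x : ℝ → Fin n → ℝ}
    (hF : ∀ i a b θ, HasDerivAt (fun θ => F i θ a b) (F' i θ a b) θ)
    (hF' : ∀ i a b, Continuous fun θ => F' i θ a b) (hx : Continuous x) (t : ℝ) :
    HasDerivAt (windowQuad τ F x) (boundaryQuad τ F x t - windowQuad τ F' x t) t := by
  unfold windowQuad
  simp only [boundaryQuad, pieceIntegral, ← Finset.sum_sub_distrib]
  simp only [quadForm_eq_sum]
  exact HasDerivAt.fun_sum fun i _ =>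
    hasDerivAt_integral_sum_mul_shift (f := fun (c : Fin n × Fin n) s => x s c.1 * x s c.2)
      (fun c θ => hF i c.1 c.2 θ) (fun c => hF' i c.1 c.2)
      (fun c => ((continuous_apply c.1).comp hx).mul ((continuous_apply c.2).comp hx)) _ _ t

theorem hasDerivAt_moment {p p' : Fin K → Fin m → ℝ → ℝ} {x : ℝ → Fin n → ℝ}
    (hp : ∀ i k θ, HasDerivAt (p i k) (p' i k θ) θ) (hp' : ∀ i k, Continuous (p' i k))
    (hx : Continuous x) (t : ℝ) :
    HasDerivAt (moment τ p x) (boundaryMoment τ p x t - moment τ p' x t) t :=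
  hasDerivAt_pi.2 fun c => hasDerivAt_integral_mul_shift (f := fun s => x s c.1.2)
    (hp _ _) (hp' _ _) ((continuous_apply _).comp hx) _ _ t

theorem _root_.HasDerivAt.dotProduct {ι : Type*} [Fintype ι] {u v : ℝ → ι → ℝ} {u' v' : ι → ℝ}
    {t : ℝ} (hu : HasDerivAt u u' t) (hv : HasDerivAt v v' t) :
    HasDerivAt (fun t => u t ⬝ᵥ v t) (u' ⬝ᵥ v t + u t ⬝ᵥ v') t := by
  simp only [_root_.dotProduct, ← Finset.sum_add_distrib]
  exact HasDerivAt.fun_sum fun a _ => (hasDerivAt_pi.1 hu a).mul (hasDerivAt_pi.1 hv a)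

theorem _root_.HasDerivAt.mulVec {ι : Type*} [Fintype ι] (B : Matrix ι ι ℝ) {u : ℝ → ι → ℝ}
    {u' : ι → ℝ} {t : ℝ} (hu : HasDerivAt u u' t) :
    HasDerivAt (fun t => B *ᵥ u t) (B *ᵥ u') t :=
  hasDerivAt_pi.2 fun a => by
    simp only [Matrix.mulVec, _root_.dotProduct]
    exact HasDerivAt.fun_sum fun b _ => (hasDerivAt_pi.1 hu b).const_mul _

theorem _root_.Matrix.IsSymm.dotProduct_mulVec_comm {ι : Type*} [Fintype ι] {B : Matrix ι ι ℝ}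
    (hB : B.IsSymm) (u v : ι → ℝ) : u ⬝ᵥ B *ᵥ v = v ⬝ᵥ B *ᵥ u := by
  rw [Matrix.dotProduct_mulVec, dotProduct_comm, ← Matrix.mulVec_transpose, hB.eq]

/-- Only the product rule is needed, because the kernel enters through finitely many moments.
Symmetry of `P` and `U` merges the mirrored terms into the factors 2. -/
theorem hasDerivAt_lyapV {P : Matrix (Fin n) (Fin n) ℝ} (hP : P.IsSymm)
    {F F' G G' : Fin K → ℝ → Matrix (Fin n) (Fin n) ℝ} {p p' : Fin K → Fin m → ℝ → ℝ}
    {U : Matrix ((Fin K × Fin n) × Fin m) ((Fin K × Fin n) × Fin m) ℝ} (hU : U.IsSymm)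
    {x : ℝ → Fin n → ℝ}
    (hF : ∀ i a b θ, HasDerivAt (fun θ => F i θ a b) (F' i θ a b) θ)
    (hF' : ∀ i a b, Continuous fun θ => F' i θ a b)
    (hG : ∀ i a b θ, HasDerivAt (fun θ => G i θ a b) (G' i θ a b) θ)
    (hG' : ∀ i a b, Continuous fun θ => G' i θ a b)
    (hp : ∀ i k θ, HasDerivAt (p i k) (p' i k θ) θ) (hp' : ∀ i k, Continuous (p' i k))
    (hx : Continuous x) {t : ℝ} {x' : Fin n → ℝ} (hx' : HasDerivAt x x' t) :
    HasDerivAt (lyapV τ P F G p U x)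
      (2 * (x t ⬝ᵥ P *ᵥ x') + 2 * (x' ⬝ᵥ windowVec τ F x t) +
        2 * (x t ⬝ᵥ boundaryVec τ F x t) - 2 * (x t ⬝ᵥ windowVec τ F' x t) +
        boundaryQuad τ G x t - windowQuad τ G' x t +
        2 * (boundaryMoment τ p x t ⬝ᵥ U *ᵥ moment τ p x t) -
        2 * (moment τ p' x t ⬝ᵥ U *ᵥ moment τ p x t)) t := by
  have hm := hasDerivAt_moment (τ := τ) hp hp' hx t
  have := (((hx'.dotProduct (hx'.mulVec P)).add
    ((hx'.dotProduct (hasDerivAt_windowVec (τ := τ) hF hF' hx t)).const_mul 2)).add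
    (hasDerivAt_windowQuad (τ := τ) hG hG' hx t)).add (hm.dotProduct (hm.mulVec U))
  refine this.congr_deriv ?_
  rw [hP.dotProduct_mulVec_comm x', hU.dotProduct_mulVec_comm (moment τ p x t), dotProduct_sub,
    sub_dotProduct]
  ring

theorem dotProduct_windowVec {F : Fin K → ℝ → Matrix (Fin n) (Fin n) ℝ} {x : ℝ → Fin n → ℝ}
    (hF : ∀ i a b, Continuous fun θ => F i θ a b) (hx : Continuous x) (t : ℝ) (v : Fin n → ℝ) :
    v ⬝ᵥ windowVec τ F x t = pieceIntegral τ fun i θ => v ⬝ᵥ F i θ *ᵥ x (t + θ) := by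
  simp only [dotProduct, windowVec]
  rw [pieceIntegral_sum _ fun c i => by simp only [dotProduct, Matrix.mulVec]; fun_prop]
  simp only [pieceIntegral_const_mul]

theorem dotProduct_moment {p : Fin K → Fin m → ℝ → ℝ} {x : ℝ → Fin n → ℝ}
    (hp : ∀ i k, Continuous (p i k)) (hx : Continuous x) (t : ℝ)
    (v : (Fin K × Fin n) × Fin m → ℝ) :
    v ⬝ᵥ moment τ p x t = pieceIntegral τ fun i θ => rowEval p v i θ ⬝ᵥ x (t + θ) := by
  simp only [dotProduct, moment, rowEval, pieceIntegral, Fintype.sum_prod_type, Finset.sum_mul]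
  refine Finset.sum_congr rfl fun i _ => ?_
  rw [intervalIntegral.integral_finsetSum fun a _ =>
    Continuous.intervalIntegrable (by fun_prop) _ _]
  refine Finset.sum_congr rfl fun a _ => ?_
  rw [intervalIntegral.integral_finsetSum fun a _ =>
    Continuous.intervalIntegrable (by fun_prop) _ _]
  simp only [mul_assoc, intervalIntegral.integral_const_mul]

theorem continuous_rowEval_dotProduct {p : Fin K → Fin m → ℝ → ℝ} {x : ℝ → Fin n → ℝ}
    (hp : ∀ i k, Continuous (p i k)) (hx : Continuous x) (t : ℝ)
    (v : (Fin K × Fin n) × Fin m → ℝ) (i : Fin K) :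
    Continuous fun θ => rowEval p v i θ ⬝ᵥ x (t + θ) := by
  simp only [dotProduct, rowEval]
  fun_prop

/-- Each pairing with a moment vector is one integral against x, so a pointwise identity of row
functions on the intervals can be integrated. This is the one-variable half of `moment_quadForm_eq`.
-/
theorem dotProduct_moment_add {p p' : Fin K → Fin m → ℝ → ℝ} {x : ℝ → Fin n → ℝ}
    (hp : ∀ i k, Continuous (p i k)) (hp' : ∀ i k, Continuous (p' i k)) (hx : Continuous x) (t : ℝ)
    {v v' w : (Fin K × Fin n) × Fin m → ℝ}
    (h : ∀ i, ∀ θ ∈ τ.interval i, ∀ b,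
      rowEval p' v i θ b + rowEval p v' i θ b = rowEval p w i θ b) :
    v ⬝ᵥ moment τ p' x t + v' ⬝ᵥ moment τ p x t = w ⬝ᵥ moment τ p x t := by
  rw [dotProduct_moment hp hx, dotProduct_moment hp hx, dotProduct_moment hp' hx,
    ← pieceIntegral_add (continuous_rowEval_dotProduct hp' hx t v)
      (continuous_rowEval_dotProduct hp hx t v')]
  refine pieceIntegral_congr fun i θ hθ => ?_
  rw [← add_dotProduct]
  congr 1
  exact funext (h i θ hθ)

/-- If the derivative of a separable kernel `pᵀ U p` along the diagonal is `pᵀ W p`, then the same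
holds for the quadratic forms of the moments. -/
theorem moment_quadForm_eq {p p' : Fin K → Fin m → ℝ → ℝ} {x : ℝ → Fin n → ℝ}
    {U W : Matrix ((Fin K × Fin n) × Fin m) ((Fin K × Fin n) × Fin m) ℝ} (hU : U.IsSymm)
    (hp : ∀ i k, Continuous (p i k)) (hp' : ∀ i k, Continuous (p' i k)) (hx : Continuous x) (t : ℝ)
    (h : ∀ i j, ∀ θ ∈ τ.interval i, ∀ ω ∈ τ.interval j, ∀ a b,
      ∑ k, ∑ l, p' i k θ * U ((i, a), k) ((j, b), l) * p j l ω +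
        ∑ k, ∑ l, p i k θ * U ((i, a), k) ((j, b), l) * p' j l ω =
      ∑ k, ∑ l, p i k θ * W ((i, a), k) ((j, b), l) * p j l ω) :
    2 * (moment τ p' x t ⬝ᵥ U *ᵥ moment τ p x t) = moment τ p x t ⬝ᵥ W *ᵥ moment τ p x t := by
  have row : ∀ (B : Matrix ((Fin K × Fin n) × Fin m) ((Fin K × Fin n) × Fin m) ℝ)
      (r : Fin K → Fin m → ℝ → ℝ) (i : Fin K) (a : Fin n) (θ : ℝ) (u : _ → ℝ),
      rowEval r (B *ᵥ u) i θ a = (fun c => ∑ k, r i k θ * B ((i, a), k) c) ⬝ᵥ u := by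
    intro B r i a θ u
    simp only [rowEval, Matrix.mulVec, dotProduct, Finset.sum_mul]
    rw [Finset.sum_comm]
    exact Finset.sum_congr rfl fun k _ => Finset.sum_congr rfl fun l _ => by ring
  have e : U *ᵥ moment τ p x t ⬝ᵥ moment τ p' x t = U *ᵥ moment τ p' x t ⬝ᵥ moment τ p x t := by
    rw [dotProduct_comm, hU.dotProduct_mulVec_comm, dotProduct_comm]
  rw [two_mul, dotProduct_comm (moment τ p' x t), dotProduct_comm _ (W *ᵥ _)]
  -- One of the two equal terms is transposed, so that the sum shows p' once on each side of `U`.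
  -- The kernel identity is then integrated in one variable, and below in the other.
  nth_rewrite 2 [e]
  refine dotProduct_moment_add hp hp' hx t fun i θ hθ a => ?_
  rw [row, row, row, add_comm]
  refine dotProduct_moment_add hp hp' hx t fun j ω hω b => ?_
  have := h i j θ hθ ω hω a b
  simp only [rowEval, Finset.sum_mul]
  rw [add_comm]
  exact (congrArg₂ (· + ·) Finset.sum_comm Finset.sum_comm).trans (this.trans Finset.sum_comm)

end Functional

/-! ### The blocks of D as boundary terms -/

section Test

variable {K n m : ℕ} {τ : Delays K}

theorem block_quadForm (B : Fin (K + 1) → Fin (K + 1) → Matrix (Fin n) (Fin n) ℝ)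
    (y : Fin (K + 1) → Fin n → ℝ) :
    (fun p : Fin (K + 1) × Fin n => y p.1 p.2) ⬝ᵥ
      (Matrix.of fun p q : Fin (K + 1) × Fin n => B p.1 q.1 p.2 q.2) *ᵥ (fun q => y q.1 q.2) =
    ∑ k, ∑ l, y k ⬝ᵥ B k l *ᵥ y l := by
  simp only [dotProduct, Matrix.mulVec, Fintype.sum_prod_type, Matrix.of_apply, Finset.mul_sum]
  exact Finset.sum_congr rfl fun k _ => Finset.sum_comm

theorem block_bilinForm (B : Fin (K + 1) → Matrix (Fin n) (Fin n) ℝ)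
    (y : Fin (K + 1) → Fin n → ℝ) (f : Fin n → ℝ) :
    (fun p : Fin (K + 1) × Fin n => y p.1 p.2) ⬝ᵥ
      (Matrix.of fun (p : Fin (K + 1) × Fin n) b => B p.1 p.2 b) *ᵥ f =
    ∑ k, y k ⬝ᵥ B k *ᵥ f := by
  simp only [dotProduct, Matrix.mulVec, Fintype.sum_prod_type, Matrix.of_apply]

/-- The additive map `B ↦ uᵀ B v`. -/
def bilinHom (u v : Fin n → ℝ) : Matrix (Fin n) (Fin n) ℝ →+ ℝ :=
  AddMonoidHom.mk' (fun B => u ⬝ᵥ B *ᵥ v) fun B C => by rw [Matrix.add_mulVec, dotProduct_add]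

theorem sum_jump_boundaryVec (F : Fin K → ℝ → Matrix (Fin n) (Fin n) ℝ) (x : ℝ → Fin n → ℝ)
    (t : ℝ) (u : Fin n → ℝ) :
    ∑ k, u ⬝ᵥ jump τ F k *ᵥ x (t + -τ.val k) = u ⬝ᵥ boundaryVec τ F x t := by
  have := sum_jump (τ := τ) F fun k => bilinHom u (x (t + -τ.val k))
  simpa [bilinHom, boundaryVec, dotProduct_sum, dotProduct_sub] using this

theorem sum_jump_boundaryQuad (F : Fin K → ℝ → Matrix (Fin n) (Fin n) ℝ) (x : ℝ → Fin n → ℝ)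
    (t : ℝ) :
    ∑ k, x (t + -τ.val k) ⬝ᵥ jump τ F k *ᵥ x (t + -τ.val k) = boundaryQuad τ F x t := by
  have := sum_jump (τ := τ) F fun k => bilinHom (x (t + -τ.val k)) (x (t + -τ.val k))
  simpa [bilinHom, boundaryQuad] using this

/-- D11 has arrow shape. Its first row and column produce the P-term with the right-hand side of the
equation and the jumps of `Q`; its diagonal holds the jumps of `S`. Summation by parts turns the
jumps into boundary terms. -/
theorem blockD11_quadForm (A : Fin (K + 1) → Matrix (Fin n) (Fin n) ℝ)
    {P : Matrix (Fin n) (Fin n) ℝ} (hP : P.IsSymm) (η : ℝ)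
    (Q S : Fin K → ℝ → Matrix (Fin n) (Fin n) ℝ) (x : ℝ → Fin n → ℝ) (t : ℝ) :
    ∑ k, ∑ l, x (t + -τ.val k) ⬝ᵥ blockD11 τ A P η Q S k l *ᵥ x (t + -τ.val l) =
      2 * (x t ⬝ᵥ P *ᵥ ∑ k, A k *ᵥ x (t + -τ.val k)) + 2 * (x t ⬝ᵥ boundaryVec τ Q x t) +
        boundaryQuad τ S x t + η * (x t ⬝ᵥ x t) := by
  have h0 : x (t + -τ.val 0) = x t := by rw [τ.val_zero, neg_zero, add_zero]
  -- First row, first column, diagonal and corner overlap at (0, 0), where they add up to the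
  -- special first block.
  have e : ∀ k l, blockD11 τ A P η Q S k l = (if k = 0 then P * A l + jump τ Q l else 0) +
      (if l = 0 then (P * A k + jump τ Q k)ᵀ else 0) + (if k = l then jump τ S k else 0) +
      (if k = 0 then if l = 0 then η • 1 else 0 else 0) := by
    intro k l
    unfold blockD11
    by_cases hk : k = 0 <;> by_cases hl : l = 0
    · subst hk hl
      simp only [if_true, Matrix.transpose_add, Matrix.transpose_mul, hP.eq]
      abel
    · subst hk
      simp [hl, Ne.symm hl]
    · subst hl
      simp [hk]
    · simp [hk, hl]
  have h1 : ∑ l, x t ⬝ᵥ (P * A l + jump τ Q l) *ᵥ x (t + -τ.val l) =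
      x t ⬝ᵥ P *ᵥ ∑ k, A k *ᵥ x (t + -τ.val k) + x t ⬝ᵥ boundaryVec τ Q x t := by
    simp only [Matrix.add_mulVec, dotProduct_add, Finset.sum_add_distrib, sum_jump_boundaryVec,
      Matrix.mulVec_sum, dotProduct_sum, Matrix.mulVec_mulVec]
  have h2 : ∀ (B : Matrix (Fin n) (Fin n) ℝ) u v, u ⬝ᵥ Bᵀ *ᵥ v = v ⬝ᵥ B *ᵥ u := fun B u v => by
    rw [Matrix.mulVec_transpose, dotProduct_comm, Matrix.dotProduct_mulVec]
  have i1 : ∑ k, ∑ l, x (t + -τ.val k) ⬝ᵥ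
      (if k = 0 then P * A l + jump τ Q l else 0) *ᵥ x (t + -τ.val l) =
      ∑ l, x t ⬝ᵥ (P * A l + jump τ Q l) *ᵥ x (t + -τ.val l) := by
    rw [Finset.sum_eq_single 0 (fun k _ hk => by simp [hk]) (by simp)]
    simp [h0]
  have i2 : ∑ k, ∑ l, x (t + -τ.val k) ⬝ᵥ
      (if l = 0 then (P * A k + jump τ Q k)ᵀ else 0) *ᵥ x (t + -τ.val l) =
      ∑ l, x t ⬝ᵥ (P * A l + jump τ Q l) *ᵥ x (t + -τ.val l) := by
    refine Finset.sum_congr rfl fun k _ => ?_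
    rw [Finset.sum_eq_single 0 (fun k _ hk => by simp [hk]) (by simp), if_pos rfl, h2, h0]
  have i3 : ∑ k, ∑ l, x (t + -τ.val k) ⬝ᵥ
      (if k = l then jump τ S k else 0) *ᵥ x (t + -τ.val l) = boundaryQuad τ S x t := by
    rw [← sum_jump_boundaryQuad]
    refine Finset.sum_congr rfl fun k _ => ?_
    rw [Finset.sum_eq_single k (fun l _ hl => by simp [Ne.symm hl]) (by simp), if_pos rfl]
  have i4 : ∑ k, ∑ l, x (t + -τ.val k) ⬝ᵥ
      (if k = 0 then if l = 0 then η • (1 : Matrix (Fin n) (Fin n) ℝ) else 0 else 0) *ᵥ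
        x (t + -τ.val l) = η * (x t ⬝ᵥ x t) := by
    rw [Finset.sum_eq_single 0 (fun k _ hk => by simp [hk]) (by simp),
      Finset.sum_eq_single 0 (fun k _ hk => by simp [hk]) (by simp), if_pos rfl, if_pos rfl, h0,
      Matrix.smul_mulVec, Matrix.one_mulVec, dotProduct_smul, smul_eq_mul]
  simp only [e, Matrix.add_mulVec, dotProduct_add, Finset.sum_add_distrib] at *
  rw [i1, i2, i3, i4]
  linarith

theorem rowEval_sum {ι : Type*} (s : Finset ι) (p : Fin K → Fin m → ℝ → ℝ)
    (v : ι → (Fin K × Fin n) × Fin m → ℝ) (j : Fin K) (θ : ℝ) :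
    rowEval p (∑ c ∈ s, v c) j θ = ∑ c ∈ s, rowEval p (v c) j θ := by
  ext b
  simp only [rowEval, Finset.sum_apply, Finset.sum_mul]
  exact Finset.sum_comm

theorem rowEval_sub (p : Fin K → Fin m → ℝ → ℝ)
    (v w : (Fin K × Fin n) × Fin m → ℝ) (j : Fin K) (θ : ℝ) :
    rowEval p (v - w) j θ = rowEval p v j θ - rowEval p w j θ := by
  ext b
  simp only [rowEval, Pi.sub_apply, sub_mul, Finset.sum_sub_distrib]

/-- The jumps of a separable kernel, in terms of the boundary terms of the moments. -/
theorem boundary_kernel {R : Fin K → Fin K → ℝ → ℝ → Matrix (Fin n) (Fin n) ℝ}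
    {p : Fin K → Fin m → ℝ → ℝ}
    {U : Matrix ((Fin K × Fin n) × Fin m) ((Fin K × Fin n) × Fin m) ℝ}
    (hR : ∀ i j, ∀ θ ∈ τ.interval i, ∀ ω ∈ τ.interval j, ∀ a b,
      R i j θ ω a b = ∑ k, ∑ l, p i k θ * U ((i, a), k) ((j, b), l) * p j l ω)
    (x : ℝ → Fin n → ℝ) (t : ℝ) (f : Fin n → ℝ) {j : Fin K} {ω : ℝ} (hω : ω ∈ τ.interval j) :
    ∑ k, x (t + -τ.val k) ⬝ᵥ jump τ (fun i s => R i j s ω) k *ᵥ f =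
      rowEval p (boundaryMoment τ p x t ᵥ* U) j ω ⬝ᵥ f := by
  have hv : ∀ i, ∀ θ ∈ τ.interval i, ∀ v : Fin n → ℝ, v ⬝ᵥ R i j θ ω *ᵥ f =
      rowEval p (fun c => ∑ a, ∑ k, v a * p i k θ * U ((i, a), k) c) j ω ⬝ᵥ f := by
    intro i θ hθ v
    simp only [dotProduct, Matrix.mulVec, rowEval, hR i j θ hθ ω hω, Finset.mul_sum,
      Finset.sum_mul]
    rw [Finset.sum_comm]
    refine Finset.sum_congr rfl fun b _ => ?_
    conv_rhs => rw [Finset.sum_comm]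
    refine Finset.sum_congr rfl fun a _ => ?_
    rw [Finset.sum_comm]
    exact Finset.sum_congr rfl fun l _ => Finset.sum_congr rfl fun k _ => by ring
  have := sum_jump (τ := τ) (fun i s => R i j s ω) fun k => bilinHom (x (t + -τ.val k)) f
  simp only [bilinHom, AddMonoidHom.mk'_apply] at this
  rw [this]
  -- The boundary moments split over the two end points of each interval; this is the form in which
  -- the jumps appear after summation by parts.
  have e : boundaryMoment τ p x t ᵥ* U = ∑ i : Fin K,
      ((fun c => ∑ a, ∑ k, x (t + -τ.val i.castSucc) a * p i k (-τ.val i.castSucc) *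
          U ((i, a), k) c) -
        fun c => ∑ a, ∑ k, x (t + -τ.val i.succ) a * p i k (-τ.val i.succ) *
          U ((i, a), k) c) := by
    ext c
    simp only [Matrix.vecMul, dotProduct, boundaryMoment, Finset.sum_apply, Pi.sub_apply,
      Fintype.sum_prod_type, ← Finset.sum_sub_distrib]
    exact Finset.sum_congr rfl fun i _ => Finset.sum_congr rfl fun a _ =>
      Finset.sum_congr rfl fun k _ => by ring
  rw [e, rowEval_sum, sum_dotProduct]
  refine Finset.sum_congr rfl fun i _ => ?_
  rw [rowEval_sub, sub_dotProduct, hv i _ (τ.right_mem i), hv i _ (τ.left_mem i)]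

end Test

/-! ### Lower bound and decay of the functional -/

section Test

variable {K n m : ℕ} {τ : Delays K}

/-- The one-sided derivatives in D and L see only values on the interval, so a smooth extension may
be differentiated instead. The interval is nondegenerate, which makes the derivative within it
unique. -/
theorem derivWithin_interval {i : Fin K} {f g : ℝ → ℝ} {g' θ : ℝ}
    (h : ∀ s ∈ τ.interval i, f s = g s) (hg : HasDerivAt g g' θ) (hθ : θ ∈ τ.interval i) :
    derivWithin f (τ.interval i) θ = g' := by
  rw [derivWithin_congr h (h θ hθ)]
  exact hg.hasDerivWithinAt.derivWithin (uniqueDiffOn_Icc (τ.left_lt_right i) θ hθ)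

theorem pieceDeriv_eq {i : Fin K} {Q F F' : ℝ → Matrix (Fin n) (Fin n) ℝ}
    (h : ∀ θ ∈ τ.interval i, Q θ = F θ)
    (hF : ∀ a b θ, HasDerivAt (fun θ => F θ a b) (F' θ a b) θ) {θ : ℝ} (hθ : θ ∈ τ.interval i) :
    pieceDeriv τ i Q θ = F' θ := by
  ext a b
  exact derivWithin_interval (fun s hs => by rw [h s hs]) (hF a b θ) hθ

theorem boundaryVec_congr {Q F : Fin K → ℝ → Matrix (Fin n) (Fin n) ℝ}
    (h : ∀ i, ∀ θ ∈ τ.interval i, Q i θ = F i θ) (x : ℝ → Fin n → ℝ) (t : ℝ) :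
    boundaryVec τ Q x t = boundaryVec τ F x t :=
  Finset.sum_congr rfl fun i _ => by rw [h i _ (τ.left_mem i), h i _ (τ.right_mem i)]

theorem boundaryQuad_congr {Q F : Fin K → ℝ → Matrix (Fin n) (Fin n) ℝ}
    (h : ∀ i, ∀ θ ∈ τ.interval i, Q i θ = F i θ) (x : ℝ → Fin n → ℝ) (t : ℝ) :
    boundaryQuad τ Q x t = boundaryQuad τ F x t :=
  Finset.sum_congr rfl fun i _ => by rw [h i _ (τ.left_mem i), h i _ (τ.right_mem i)]

theorem continuous_quadForm {F : Fin K → ℝ → Matrix (Fin n) (Fin n) ℝ} {x : ℝ → Fin n → ℝ}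
    (hF : ∀ i a b, Continuous fun θ => F i θ a b) (hx : Continuous x) (t : ℝ) (i : Fin K) :
    Continuous fun θ => x (t + θ) ⬝ᵥ F i θ *ᵥ x (t + θ) := by
  simp only [dotProduct, Matrix.mulVec]
  fun_prop

theorem continuous_bilinForm {F : Fin K → ℝ → Matrix (Fin n) (Fin n) ℝ} {x : ℝ → Fin n → ℝ}
    (hF : ∀ i a b, Continuous fun θ => F i θ a b) (hx : Continuous x) (t : ℝ) (v : Fin n → ℝ)
    (i : Fin K) : Continuous fun θ => v ⬝ᵥ F i θ *ᵥ x (t + θ) := by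
  simp only [dotProduct, Matrix.mulVec]
  fun_prop

/-- Lower bound for the functional. -/
theorem le_lyapV (hK : 1 ≤ K) {d : ℕ} {P : Matrix (Fin n) (Fin n) ℝ} {η : ℝ}
    {Q S F G : Fin K → ℝ → Matrix (Fin n) (Fin n) ℝ} (h1 : lyapM τ P η Q S ∈ G1 τ d)
    (hQF : ∀ i, ∀ θ ∈ τ.interval i, Q i θ = F i θ) (hSG : ∀ i, ∀ θ ∈ τ.interval i, S i θ = G i θ)
    (hF : ∀ i a b, Continuous fun θ => F i θ a b) (hG : ∀ i a b, Continuous fun θ => G i θ a b)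
    (p : Fin K → Fin m → ℝ → ℝ) {U : Matrix ((Fin K × Fin n) × Fin m) ((Fin K × Fin n) × Fin m) ℝ}
    (hU : U.PosSemidef) {x : ℝ → Fin n → ℝ} (hx : Continuous x) (t : ℝ) :
    η * (x t ⬝ᵥ x t) ≤ lyapV τ P F G p U x t := by
  have h := IsPosUpToSpacing.pieceIntegral_nonneg h1 (x t) (z := fun θ => x (t + θ)) (by fun_prop)
  have hU' := hU.dotProduct_mulVec_nonneg (moment τ p x t)
  rw [star_trivial] at hU'
  -- The upper left block has no factor `τ.last` but gains it by integrating a constant; the other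
  -- blocks carry it explicitly. The inequality is thus `τ.last` times the desired one, up to the
  -- nonnegative moment term.
  rw [pieceIntegral_congr (g := fun i θ => x t ⬝ᵥ (P - η • 1) *ᵥ x t +
    (2 * τ.last) * (x t ⬝ᵥ F i θ *ᵥ x (t + θ)) + τ.last * (x (t + θ) ⬝ᵥ G i θ *ᵥ x (t + θ))),
    pieceIntegral_add, pieceIntegral_add, pieceIntegral_const_mul, pieceIntegral_const_mul,
    pieceIntegral_const, ← dotProduct_windowVec hF hx, Matrix.sub_mulVec, Matrix.smul_mulVec,
    Matrix.one_mulVec, dotProduct_sub, dotProduct_smul, smul_eq_mul] at h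
  · refine le_of_mul_le_mul_left ?_ (τ.last_pos hK)
    have := mul_nonneg (τ.last_pos hK).le hU'
    unfold lyapV windowQuad
    linarith
  · exact fun i => continuous_const
  · exact fun i => (continuous_bilinForm hF hx t _ i).const_mul _
  · exact fun i => continuous_const.add ((continuous_bilinForm hF hx t _ i).const_mul _)
  · exact fun i => (continuous_quadForm hG hx t i).const_mul _
  · intro i θ hθ
    rw [lyapM, sumElim_quadForm, hQF i θ hθ, hSG i θ hθ, Matrix.smul_mulVec, Matrix.smul_mulVec,
      Matrix.smul_mulVec, dotProduct_smul, dotProduct_smul, dotProduct_smul,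
      Matrix.mulVec_transpose, dotProduct_comm (x (t + θ)) (_ ᵥ* _), ← Matrix.dotProduct_mulVec]
    simp only [smul_eq_mul]
    ring

/-- Decay of the functional along trajectories. -/
theorem deriv_lyapV_le (hK : 1 ≤ K) {d : ℕ} {A : Fin (K + 1) → Matrix (Fin n) (Fin n) ℝ}
    {P : Matrix (Fin n) (Fin n) ℝ} (hP : P.IsSymm) {η : ℝ}
    {Q S F G F' G' : Fin K → ℝ → Matrix (Fin n) (Fin n) ℝ}
    {R : Fin K → Fin K → ℝ → ℝ → Matrix (Fin n) (Fin n) ℝ}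
    {p p' : Fin K → Fin m → ℝ → ℝ}
    {U W : Matrix ((Fin K × Fin n) × Fin m) ((Fin K × Fin n) × Fin m) ℝ}
    (h3 : -lyapD τ A P η Q S R ∈ G3 τ d)
    (hQF : ∀ i, ∀ θ ∈ τ.interval i, Q i θ = F i θ) (hSG : ∀ i, ∀ θ ∈ τ.interval i, S i θ = G i θ)
    (hF : ∀ i a b θ, HasDerivAt (fun θ => F i θ a b) (F' i θ a b) θ)
    (hF' : ∀ i a b, Continuous fun θ => F' i θ a b)
    (hG : ∀ i a b θ, HasDerivAt (fun θ => G i θ a b) (G' i θ a b) θ)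
    (hG' : ∀ i a b, Continuous fun θ => G' i θ a b)
    (hp : ∀ i k θ, HasDerivAt (p i k) (p' i k θ) θ) (hp' : ∀ i k, Continuous (p' i k))
    (hR : ∀ i j, ∀ θ ∈ τ.interval i, ∀ ω ∈ τ.interval j, ∀ a b,
      R i j θ ω a b = ∑ k, ∑ l, p i k θ * U ((i, a), k) ((j, b), l) * p j l ω)
    (hL : ∀ i j, ∀ θ ∈ τ.interval i, ∀ ω ∈ τ.interval j, ∀ a b,
      lyapL τ R i j θ ω a b = ∑ k, ∑ l, p i k θ * W ((i, a), k) ((j, b), l) * p j l ω)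
    (hU : U.IsSymm) (hW : W.PosSemidef) {x : ℝ → Fin n → ℝ} (hx : Continuous x) {t : ℝ}
    (hx' : HasDerivAt x (∑ k, A k *ᵥ x (t + -τ.val k)) t) :
    ∃ v, HasDerivAt (lyapV τ P F G p U x) v t ∧ v ≤ -(η * (x t ⬝ᵥ x t)) := by
  refine ⟨_, hasDerivAt_lyapV hP hU hF hF' hG hG' hp hp' hx hx', ?_⟩
  set x' := ∑ k, A k *ᵥ x (t + -τ.val k) with hx'def
  have hpc : ∀ i k, Continuous (p i k) := fun i k =>
    continuous_iff_continuousAt.2 fun θ => (hp i k θ).continuousAt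
  have hFc : ∀ i a b, Continuous fun θ => F i θ a b := fun i a b =>
    continuous_iff_continuousAt.2 fun θ => (hF i a b θ).continuousAt
  -- On the intervals L is the diagonal derivative of the separable kernel, so the term with p' in
  -- V' is a form in `W`, hence of definite sign.
  have hLW : 2 * (moment τ p' x t ⬝ᵥ U *ᵥ moment τ p x t) =
      moment τ p x t ⬝ᵥ W *ᵥ moment τ p x t := by
    refine moment_quadForm_eq hU hpc hp' hx t fun i j θ hθ ω hω a b => ?_
    rw [← hL i j θ hθ ω hω a b]
    refine congrArg₂ (· + ·) (Eq.symm ?_) (Eq.symm ?_)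
    · exact derivWithin_interval (fun s hs => hR i j s hs ω hω a b)
        (HasDerivAt.fun_sum fun k _ => HasDerivAt.fun_sum fun l _ =>
          ((hp i k θ).mul_const _).mul_const _) hθ
    · exact derivWithin_interval (fun s hs => hR i j θ hθ s hs a b)
        (HasDerivAt.fun_sum fun k _ => HasDerivAt.fun_sum fun l _ =>
          (hp j l ω).const_mul _) hω
  have hW' := hW.dotProduct_mulVec_nonneg (moment τ p x t)
  rw [star_trivial, ← hLW] at hW'
  -- The constant component collects all delayed values x(t - τ_k); the varying one is x(t + θ).
  have h := IsPosUpToSpacing.pieceIntegral_nonneg h3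
    (fun q : Fin (K + 1) × Fin n => x (t + -τ.val q.1) q.2) (z := fun θ => x (t + θ)) (by fun_prop)
  rw [pieceIntegral_congr (g := fun i θ => -(2 * (x t ⬝ᵥ P *ᵥ x') +
      2 * (x t ⬝ᵥ boundaryVec τ F x t) + boundaryQuad τ G x t + η * (x t ⬝ᵥ x t)) +
    (-(2 * τ.last)) * (rowEval p (boundaryMoment τ p x t ᵥ* U) i θ ⬝ᵥ x (t + θ)) +
    (-(2 * τ.last)) * (x' ⬝ᵥ F i θ *ᵥ x (t + θ)) + (2 * τ.last) * (x t ⬝ᵥ F' i θ *ᵥ x (t + θ)) +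
    τ.last * (x (t + θ) ⬝ᵥ G' i θ *ᵥ x (t + θ))),
    pieceIntegral_add, pieceIntegral_add, pieceIntegral_add, pieceIntegral_add,
    pieceIntegral_const_mul, pieceIntegral_const_mul, pieceIntegral_const_mul,
    pieceIntegral_const_mul, pieceIntegral_const, ← dotProduct_moment hpc hx,
    ← dotProduct_windowVec hFc hx, ← dotProduct_windowVec hF' hx, ← Matrix.dotProduct_mulVec] at h
  · refine le_of_mul_le_mul_left ?_ (τ.last_pos hK)
    have := mul_nonneg (τ.last_pos hK).le hW'
    unfold windowQuad
    linarith
  · exact fun i => continuous_const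
  · exact fun i => (continuous_rowEval_dotProduct hpc hx t _ i).const_mul _
  · exact fun i => continuous_const.add ((continuous_rowEval_dotProduct hpc hx t _ i).const_mul _)
  · exact fun i => (continuous_bilinForm hFc hx t _ i).const_mul _
  · exact fun i => (continuous_const.add
      ((continuous_rowEval_dotProduct hpc hx t _ i).const_mul _)).add
      ((continuous_bilinForm hFc hx t _ i).const_mul _)
  · exact fun i => (continuous_bilinForm hF' hx t _ i).const_mul _
  · exact fun i => ((continuous_const.add
      ((continuous_rowEval_dotProduct hpc hx t _ i).const_mul _)).add
      ((continuous_bilinForm hFc hx t _ i).const_mul _)).add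
      ((continuous_bilinForm hF' hx t _ i).const_mul _)
  · exact fun i => (continuous_quadForm hG' hx t i).const_mul _
  · intro j θ hθ
    have h0 : x (t + -τ.val 0) = x t := by rw [τ.val_zero, neg_zero, add_zero]
    -- The three parts of D12 match three terms of V': kernel jumps give the boundary moments, the
    -- `A k` assemble x', and the derivative of `Q` sits only in block 0.
    have e12 : ∑ k, x (t + -τ.val k) ⬝ᵥ blockD12 τ A Q R j θ k *ᵥ x (t + θ) =
        rowEval p (boundaryMoment τ p x t ᵥ* U) j θ ⬝ᵥ x (t + θ) +
          x' ⬝ᵥ F j θ *ᵥ x (t + θ) - x t ⬝ᵥ F' j θ *ᵥ x (t + θ) := by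
      simp only [blockD12, Matrix.add_mulVec, Matrix.sub_mulVec, dotProduct_add, dotProduct_sub,
        Finset.sum_add_distrib, Finset.sum_sub_distrib, boundary_kernel hR x t _ hθ]
      refine congrArg₂ (· - ·) (congrArg₂ (· + ·) rfl ?_) ?_
      · rw [hx'def, sum_dotProduct]
        refine Finset.sum_congr rfl fun k _ => ?_
        rw [← Matrix.mulVec_mulVec, Matrix.dotProduct_mulVec, Matrix.vecMul_transpose, hQF j θ hθ]
      · rw [Finset.sum_eq_single 0 (fun k _ hk => by simp [hk]) (by simp), if_pos rfl, h0,
          pieceDeriv_eq (hQF j) (hF j) hθ]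
    have e := block_bilinForm (blockD12 τ A Q R j θ) (fun k => x (t + -τ.val k)) (x (t + θ))
    rw [e12] at e
    have e11 := block_quadForm (blockD11 τ A P η Q S) (fun k => x (t + -τ.val k))
    rw [blockD11_quadForm A hP, boundaryVec_congr hQF, boundaryQuad_congr hSG] at e11
    rw [Pi.neg_apply, Pi.neg_apply, Matrix.neg_mulVec, dotProduct_neg, lyapD, sumElim_quadForm,
      Matrix.smul_mulVec, Matrix.smul_mulVec, Matrix.smul_mulVec, dotProduct_smul, dotProduct_smul,
      dotProduct_smul, Matrix.mulVec_transpose, dotProduct_comm (x (t + θ)) (_ ᵥ* _),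
      ← Matrix.dotProduct_mulVec, e, e11, pieceDeriv_eq (hSG j) (hG j) hθ, Matrix.neg_mulVec,
      dotProduct_neg]
    simp only [smul_eq_mul]
    ring

/-- Under the hypotheses of the stability test there is a complete quadratic functional with
smooth coefficients that is positive and decays along solutions. -/
theorem exists_lyapV (hK : 1 ≤ K) {d : ℕ} {A : Fin (K + 1) → Matrix (Fin n) (Fin n) ℝ}
    {P : Matrix (Fin n) (Fin n) ℝ} (hP : P.IsSymm) {η : ℝ}
    {Q S : Fin K → ℝ → Matrix (Fin n) (Fin n) ℝ}
    {R : Fin K → Fin K → ℝ → ℝ → Matrix (Fin n) (Fin n) ℝ}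
    (h1 : lyapM τ P η Q S ∈ G1 τ d) (h2 : R ∈ G2 τ d)
    (h3 : -lyapD τ A P η Q S R ∈ G3 τ d) (h4 : lyapL τ R ∈ G2 τ d) :
    ∃ (F G : Fin K → ℝ → Matrix (Fin n) (Fin n) ℝ) (p : Fin K → Fin (d / 2 + 1) → ℝ → ℝ)
      (U : Matrix ((Fin K × Fin n) × Fin (d / 2 + 1)) ((Fin K × Fin n) × Fin (d / 2 + 1)) ℝ),
      (∀ i a b, Continuous fun θ => F i θ a b) ∧ (∀ i a b, Continuous fun θ => G i θ a b) ∧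
      (∀ i k, Continuous (p i k)) ∧ ∀ x : ℝ → Fin n → ℝ, Continuous x →
        (∀ t, η * (x t ⬝ᵥ x t) ≤ lyapV τ P F G p U x t) ∧
        ∀ t, HasDerivAt x (∑ k, A k *ᵥ x (t + -τ.val k)) t →
          ∃ v, HasDerivAt (lyapV τ P F G p U x) v t ∧ v ≤ -(η * (x t ⬝ᵥ x t)) := by
  obtain ⟨N, T, -, hN, -, -⟩ := id h1
  obtain ⟨R₀, ⟨U, hU, hRU⟩, hR⟩ := h2
  obtain ⟨L₀, ⟨W, hW, hLW⟩, hL⟩ := h4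
  have hτ := (τ.last_pos hK).ne'
  have hpoly : ∀ (q : Polynomial ℝ) θ, HasDerivAt (fun θ => τ.last⁻¹ * q.eval θ)
      (τ.last⁻¹ * q.derivative.eval θ) θ := fun q θ => (q.hasDerivAt θ).const_mul _
  have hpolyc : ∀ (q : Polynomial ℝ), Continuous fun θ => τ.last⁻¹ * q.derivative.eval θ :=
    fun q => continuous_const.mul q.derivative.continuous
  have hpow : ∀ (i : Fin K) (k : Fin (d / 2 + 1)) θ, HasDerivAt (fun θ => τ.rescale i θ ^ (k : ℕ))
      ((k : ℕ) * τ.rescale i θ ^ ((k : ℕ) - 1) * (τ.last / τ.width i)) θ := fun i k θ => by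
    refine HasDerivAt.fun_pow ?_ _
    unfold Delays.rescale
    simpa using ((hasDerivAt_id θ).const_mul (τ.last / τ.width i)).add_const
      (τ.val i.castSucc * (τ.last / τ.width i))
  have hrc : ∀ i, Continuous (τ.rescale i) := fun i => by unfold Delays.rescale; fun_prop
  -- `Q` and `S` are not assumed differentiable, but membership in `G1` makes `τ.last • Q i` and
  -- `τ.last • S i` polynomial on the i-th interval. Dividing by `τ.last` gives smooth extensions to
  -- ℝ.
  let F : Fin K → ℝ → Matrix (Fin n) (Fin n) ℝ := fun i θ =>
    Matrix.of fun a b => τ.last⁻¹ * (N i (Sum.inl a) (Sum.inr b)).eval θ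
  let G : Fin K → ℝ → Matrix (Fin n) (Fin n) ℝ := fun i θ =>
    Matrix.of fun a b => τ.last⁻¹ * (N i (Sum.inr a) (Sum.inr b)).eval θ
  let F' : Fin K → ℝ → Matrix (Fin n) (Fin n) ℝ := fun i θ =>
    Matrix.of fun a b => τ.last⁻¹ * (N i (Sum.inl a) (Sum.inr b)).derivative.eval θ
  let G' : Fin K → ℝ → Matrix (Fin n) (Fin n) ℝ := fun i θ =>
    Matrix.of fun a b => τ.last⁻¹ * (N i (Sum.inr a) (Sum.inr b)).derivative.eval θ
  have hQF : ∀ i, ∀ θ ∈ τ.interval i, Q i θ = F i θ := fun i θ hθ => by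
    ext a b
    have := congrFun (congrFun (hN i θ hθ) (Sum.inl a)) (Sum.inr b)
    simp only [lyapM, Matrix.fromBlocks_apply₁₂, evalAt, Matrix.map_apply, Matrix.smul_apply,
      smul_eq_mul] at this
    simp only [F, Matrix.of_apply, ← this]
    field_simp
  have hSG : ∀ i, ∀ θ ∈ τ.interval i, S i θ = G i θ := fun i θ hθ => by
    ext a b
    have := congrFun (congrFun (hN i θ hθ) (Sum.inr a)) (Sum.inr b)
    simp only [lyapM, Matrix.fromBlocks_apply₂₂, evalAt, Matrix.map_apply, Matrix.smul_apply,
      smul_eq_mul] at this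
    simp only [G, Matrix.of_apply, ← this]
    field_simp
  have hF : ∀ i a b θ, HasDerivAt (fun θ => F i θ a b) (F' i θ a b) θ :=
    fun i a b => hpoly (N i (Sum.inl a) (Sum.inr b))
  have hG : ∀ i a b θ, HasDerivAt (fun θ => G i θ a b) (G' i θ a b) θ :=
    fun i a b => hpoly (N i (Sum.inr a) (Sum.inr b))
  have hFc : ∀ i a b, Continuous fun θ => F i θ a b := fun i a b =>
    continuous_iff_continuousAt.2 fun θ => (hF i a b θ).continuousAt
  have hGc : ∀ i a b, Continuous fun θ => G i θ a b := fun i a b =>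
    continuous_iff_continuousAt.2 fun θ => (hG i a b θ).continuousAt
  -- The same rescaled monomials serve `R` and L, so both are expressed in the same moments.
  refine ⟨F, G, fun i k θ => τ.rescale i θ ^ (k : ℕ), U, hFc, hGc, fun i k => (hrc i).pow _,
    fun x hx => ⟨le_lyapV hK h1 hQF hSG hFc hGc _ hU hx, fun t ht => ?_⟩⟩
  exact deriv_lyapV_le hK hP h3 hQF hSG hF (fun i a b => hpolyc _) hG (fun i a b => hpolyc _) hpow
    (fun i k => by have := hrc i; fun_prop)
    (fun i j θ hθ ω hω a b => by rw [hR i j θ hθ ω hω, hRU])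
    (fun i j θ hθ ω hω a b => by rw [hL i j θ hθ ω hω, hLW])
    (by simpa using hU.isHermitian) hW hx ht

end Test

/-! ## Existence of solutions -/

section Existence

variable {E : Type*} [NormedAddCommGroup E] [NormedSpace ℝ E]

open scoped BoundedContinuousFunction

/-- Integrating exp(μs) gains a factor 1/μ, which makes the integral operator contract for large μ.
The `max t 0` makes the expression vanish at negative times. -/
theorem norm_exp_smul_integral_le {μ : ℝ} (hμ : 0 < μ) {g : ℝ → E}
    {D : ℝ} (hD : 0 ≤ D) (hgD : ∀ s, 0 ≤ s → ‖g s‖ ≤ D * Real.exp (μ * s)) (t : ℝ) :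
    ‖Real.exp (-(μ * t)) • ∫ s in (0 : ℝ)..(max t 0), g s‖ ≤ D / μ := by
  have hd : 0 ≤ D / μ := div_nonneg hD hμ.le
  rcases le_total t 0 with ht | ht
  · simpa [max_eq_right ht] using hd
  rw [max_eq_left ht, norm_smul, Real.norm_of_nonneg (Real.exp_pos _).le]
  have hder : ∀ s ∈ uIcc 0 t, HasDerivAt (fun s => D / μ * Real.exp (μ * s))
      (D * Real.exp (μ * s)) s := fun s _ => by
    have := (((hasDerivAt_id s).const_mul μ).exp).const_mul (D / μ)
    refine this.congr_deriv ?_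
    simp only [id, mul_one]
    field_simp
  have h1 : ‖∫ s in (0 : ℝ)..t, g s‖ ≤ D / μ * Real.exp (μ * t) := by
    refine (intervalIntegral.norm_integral_le_of_norm_le ht
      (MeasureTheory.ae_of_all _ fun s hs => hgD s hs.1.le)
      (Continuous.intervalIntegrable (by fun_prop) _ _)).trans ?_
    rw [intervalIntegral.integral_eq_sub_of_hasDerivAt hder
      (Continuous.intervalIntegrable (by fun_prop) _ _)]
    simpa using hd
  calc Real.exp (-(μ * t)) * ‖∫ s in (0 : ℝ)..t, g s‖
      ≤ Real.exp (-(μ * t)) * (D / μ * Real.exp (μ * t)) := by gcongr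
    _ = D / μ * (Real.exp (-(μ * t)) * Real.exp (μ * t)) := by ring
    _ = D / μ := by rw [← Real.exp_add, neg_add_cancel, Real.exp_zero, mul_one]

/-- A linear equation with finitely many delays `r k ≥ 0` has a global solution that extends the
initial function `Φ`. -/
theorem exists_delay_solution [CompleteSpace E] {ι : Type*} [Fintype ι] (B : ι → E →L[ℝ] E)
    {r : ι → ℝ} (hr : ∀ k, 0 ≤ r k) (Φ : ℝ →ᵇ E) (hΦ : ∀ t, 0 ≤ t → Φ t = Φ 0) :
    ∃ X : ℝ → E, Continuous X ∧ (∀ t ≤ 0, X t = Φ t) ∧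
      ∀ t, 0 ≤ t → HasDerivWithinAt X (∑ k, B k (X (t + -r k))) (Ici 0) t := by
  set C : ℝ := ∑ k, ‖B k‖ with hC
  have hC0 : 0 ≤ C := Finset.sum_nonneg fun k _ => norm_nonneg _
  -- The Lipschitz constant of the operator is C/μ, which this choice keeps below 1/2.
  set μ : ℝ := 2 * C + 1 with hμ
  have hμ0 : 0 < μ := by positivity
  -- The ansatz is X(t) = exp(μt) y(t) + Φ(t) with `y` bounded; `g y` is then the right-hand side of
  -- the equation.
  let g : (ℝ →ᵇ E) → ℝ → E := fun y s =>
    ∑ k, B k (Real.exp (μ * (s + -r k)) • y (s + -r k) + Φ (s + -r k))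
  have hgc : ∀ y, Continuous (g y) := fun y => by fun_prop
  have hexp : ∀ s k, Real.exp (μ * (s + -r k)) ≤ Real.exp (μ * s) := fun s k =>
    Real.exp_le_exp.2 (mul_le_mul_of_nonneg_left (by linarith [hr k]) hμ0.le)
  have hgb : ∀ y s, 0 ≤ s → ‖g y s‖ ≤ C * (‖y‖ + ‖Φ‖) * Real.exp (μ * s) := by
    intro y s hs
    rw [hC, Finset.sum_mul, Finset.sum_mul]
    refine norm_sum_le_of_le _ fun k _ => ((B k).le_opNorm _).trans ?_
    rw [mul_assoc]
    refine mul_le_mul_of_nonneg_left ((norm_add_le _ _).trans ?_) (norm_nonneg _)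
    rw [norm_smul, Real.norm_of_nonneg (Real.exp_pos _).le, add_mul ‖y‖, mul_comm (Real.exp _)]
    refine add_le_add (mul_le_mul (y.norm_coe_le_norm _) (hexp s k) (Real.exp_pos _).le
      (norm_nonneg _)) ((Φ.norm_coe_le_norm _).trans ?_)
    exact le_mul_of_one_le_right (norm_nonneg _) (Real.one_le_exp (by positivity))
  have hgl : ∀ y z s, 0 ≤ s → ‖g y s - g z s‖ ≤ C * ‖y - z‖ * Real.exp (μ * s) := by
    intro y z s hs
    rw [hC, Finset.sum_mul, Finset.sum_mul, ← Finset.sum_sub_distrib]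
    refine norm_sum_le_of_le _ fun k _ => ?_
    rw [← map_sub, add_sub_add_right_eq_sub, ← smul_sub]
    refine ((B k).le_opNorm _).trans ?_
    rw [mul_assoc]
    refine mul_le_mul_of_nonneg_left ?_ (norm_nonneg _)
    rw [norm_smul, Real.norm_of_nonneg (Real.exp_pos _).le, mul_comm]
    exact mul_le_mul ((y - z).norm_coe_le_norm _) (hexp s k) (Real.exp_pos _).le (norm_nonneg _)
  have hIc : ∀ y, Continuous fun t => ∫ s in (0 : ℝ)..t, g y s := fun y =>
    intervalIntegral.continuous_primitive (fun a b => (hgc y).intervalIntegrable a b) 0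
  let T : (ℝ →ᵇ E) → (ℝ →ᵇ E) := fun y => BoundedContinuousFunction.ofNormedAddCommGroup
    (fun t => Real.exp (-(μ * t)) • ∫ s in (0 : ℝ)..(max t 0), g y s)
    (Continuous.smul (by fun_prop) ((hIc y).comp (by fun_prop : Continuous fun t => max t (0 : ℝ))))
    (C * (‖y‖ + ‖Φ‖) / μ) (norm_exp_smul_integral_le hμ0 (by positivity) (hgb y))
  have hT : ContractingWith (1 / 2) T := by
    refine ⟨by rw [← NNReal.coe_lt_coe]; norm_num, LipschitzWith.of_dist_le_mul fun y z => ?_⟩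
    rw [dist_eq_norm, dist_eq_norm]
    refine (BoundedContinuousFunction.norm_le (by positivity)).2 fun t => ?_
    have e : (T y - T z) t = Real.exp (-(μ * t)) • ∫ s in (0 : ℝ)..(max t 0), (g y s - g z s) := by
      rw [intervalIntegral.integral_sub ((hgc y).intervalIntegrable _ _)
        ((hgc z).intervalIntegrable _ _), smul_sub]
      rfl
    rw [e]
    refine (norm_exp_smul_integral_le hμ0 (by positivity) (hgl y z) t).trans ?_
    rw [div_le_iff₀ hμ0]
    have := norm_nonneg (y - z)
    push_cast
    rw [hμ]
    nlinarith
  set y := hT.fixedPoint T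
  have hy : T y = y := hT.fixedPoint_isFixedPt
  have hyt : ∀ t, Real.exp (μ * t) • y t = ∫ s in (0 : ℝ)..(max t 0), g y s := by
    intro t
    have hTt : T y t = Real.exp (-(μ * t)) • ∫ s in (0 : ℝ)..(max t 0), g y s := rfl
    rw [hy] at hTt
    rw [hTt, smul_smul, ← Real.exp_add, add_neg_cancel, Real.exp_zero, one_smul]
  refine ⟨fun t => Real.exp (μ * t) • y t + Φ t, by fun_prop, fun t ht => ?_, fun t ht => ?_⟩
  · simp only [hyt, max_eq_right ht, intervalIntegral.integral_same, zero_add]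
  -- For t ≥ 0 the function Φ is frozen at `Φ 0`, so it adds nothing to the derivative.
  · have h1 : HasDerivAt (fun t => (∫ s in (0 : ℝ)..t, g y s) + Φ 0) (g y t) t :=
      (intervalIntegral.integral_hasDerivAt_right ((hgc y).intervalIntegrable _ _)
        ((hgc y).stronglyMeasurableAtFilter _ _) (hgc y).continuousAt).add_const _
    refine h1.hasDerivWithinAt.congr (fun s hs => ?_) ?_
    · rw [hyt, max_eq_left hs, hΦ s hs]
    · rw [hyt, max_eq_left ht, hΦ t ht]

end Existence

/-! ## Energy estimates -/

section Energy

variable {K n m : ℕ} {τ : Delays K}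

/-- The parameter space is general because two cases are needed: time, for V along a trajectory, and
the initial function, for stability. -/
theorem continuous_lyapV {T : Type*} [TopologicalSpace T] [FirstCountableTopology T]
    (P : Matrix (Fin n) (Fin n) ℝ) {F G : Fin K → ℝ → Matrix (Fin n) (Fin n) ℝ}
    {p : Fin K → Fin m → ℝ → ℝ} (U : Matrix ((Fin K × Fin n) × Fin m) ((Fin K × Fin n) × Fin m) ℝ)
    (hF : ∀ i a b, Continuous fun θ => F i θ a b) (hG : ∀ i a b, Continuous fun θ => G i θ a b)
    (hp : ∀ i k, Continuous (p i k)) {Y : T → ℝ → Fin n → ℝ}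
    (hY : Continuous fun q : T × ℝ => Y q.1 q.2) :
    Continuous fun s => lyapV τ P F G p U (Y s) 0 := by
  have hYs : Continuous fun s => Y s 0 := hY.comp (by fun_prop : Continuous fun s : T => (s, (0 : ℝ)))
  have hY0 : Continuous fun q : T × ℝ => Y q.1 (0 + q.2) := by simpa using hY
  have h1 : Continuous fun s => windowVec τ F (Y s) 0 := by
    refine continuous_pi fun a => ?_
    simp only [windowVec, pieceIntegral]
    refine continuous_finsetSum _ fun i _ =>
      intervalIntegral.continuous_parametric_intervalIntegral_of_continuous' ?_ _ _
    simp only [Function.uncurry_def, Matrix.mulVec, dotProduct]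
    fun_prop
  have h2 : Continuous fun s => windowQuad τ G (Y s) 0 := by
    simp only [windowQuad, pieceIntegral]
    refine continuous_finsetSum _ fun i _ =>
      intervalIntegral.continuous_parametric_intervalIntegral_of_continuous' ?_ _ _
    simp only [Function.uncurry_def, Matrix.mulVec, dotProduct]
    fun_prop
  have h3 : Continuous fun s => moment τ p (Y s) 0 := by
    refine continuous_pi fun c =>
      intervalIntegral.continuous_parametric_intervalIntegral_of_continuous' ?_ _ _
    simp only [Function.uncurry_def]
    fun_prop
  simp only [lyapV, Matrix.mulVec, dotProduct]
  fun_prop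

theorem lyapV_shift (P : Matrix (Fin n) (Fin n) ℝ) (F G : Fin K → ℝ → Matrix (Fin n) (Fin n) ℝ)
    (p : Fin K → Fin m → ℝ → ℝ) (U : Matrix ((Fin K × Fin n) × Fin m) ((Fin K × Fin n) × Fin m) ℝ)
    (x : ℝ → Fin n → ℝ) (t : ℝ) :
    lyapV τ P F G p U x t = lyapV τ P F G p U (fun s => x (t + s)) 0 := by
  have h3 : moment τ p x t = moment τ p (fun s => x (t + s)) 0 := by
    ext c
    simp only [moment, zero_add]
  have h1 : windowVec τ F x t = windowVec τ F (fun s => x (t + s)) 0 := by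
    ext a
    simp only [windowVec, zero_add]
  simp only [lyapV, windowQuad, h1, h3, zero_add, add_zero]

theorem lyapV_congr (P : Matrix (Fin n) (Fin n) ℝ) (F G : Fin K → ℝ → Matrix (Fin n) (Fin n) ℝ)
    (p : Fin K → Fin m → ℝ → ℝ) (U : Matrix ((Fin K × Fin n) × Fin m) ((Fin K × Fin n) × Fin m) ℝ)
    {x y : ℝ → Fin n → ℝ} (h : ∀ θ ∈ Icc (-τ.last) 0, x θ = y θ) :
    lyapV τ P F G p U x 0 = lyapV τ P F G p U y 0 := by
  have h0 : x 0 = y 0 := h 0 (by simpa [τ.val_zero] using τ.neg_mem 0)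
  have hI : ∀ i, ∀ θ ∈ τ.interval i, x (0 + θ) = y (0 + θ) := fun i θ hθ => by
    rw [zero_add, h θ (τ.interval_subset i hθ)]
  have h1 : windowVec τ F x 0 = windowVec τ F y 0 :=
    funext fun a => pieceIntegral_congr fun i θ hθ => by rw [hI i θ hθ]
  have h2 : windowQuad τ G x 0 = windowQuad τ G y 0 :=
    pieceIntegral_congr fun i θ hθ => by rw [hI i θ hθ]
  have h3 : moment τ p x 0 = moment τ p y 0 :=
    funext fun c => intervalIntegral.integral_congr fun θ hθ => by
      simp only [hI c.1.1 θ (τ.uIcc_eq c.1.1 ▸ hθ)]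
  rw [lyapV, lyapV, h0, h1, h2, h3]

/-- A continuous function `V` with `V' ≤ -f` satisfies `V(t) + ∫ f ≤ V(0)`. -/
theorem add_integral_le_of_deriv_le {V f : ℝ → ℝ} (hV : Continuous V) (hf : Continuous f)
    (h : ∀ t, 0 < t → ∃ v, HasDerivAt V v t ∧ v ≤ -f t) {t : ℝ} (ht : 0 ≤ t) :
    V t + ∫ s in (0 : ℝ)..t, f s ≤ V 0 := by
  have hI : ∀ t, HasDerivAt (fun t => ∫ s in (0 : ℝ)..t, f s) (f t) t := fun t =>
    intervalIntegral.integral_hasDerivAt_right (hf.intervalIntegrable _ _)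
      (hf.stronglyMeasurableAtFilter _ _) hf.continuousAt
  -- Differentiability is needed only in the interior: a solution has just a one-sided derivative at
  -- 0, where continuity suffices.
  have hanti : AntitoneOn (fun t => V t + ∫ s in (0 : ℝ)..t, f s) (Ici 0) := by
    refine antitoneOn_of_deriv_nonpos (convex_Ici 0)
      (hV.add (continuous_iff_continuousAt.2 fun t => (hI t).continuousAt)).continuousOn
      (fun t ht => ?_) fun t ht => ?_ <;> rw [interior_Ici, mem_Ioi] at ht <;>
      obtain ⟨v, hv, hvf⟩ := h t ht
    · exact (hv.add (hI t)).differentiableAt.differentiableWithinAt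
    · rw [(hv.fun_add (hI t)).deriv]
      linarith
  simpa using hanti self_mem_Ici ht ht

end Energy

/-! ### Energy bound, convergence to zero and existence of trajectories -/

section Stability

variable {K n : ℕ} {τ : Delays K}

/-- The integrated Lyapunov inequality: `η‖X(t)‖² + η∫‖X‖²` is bounded by a quantity that vanishes
at zero and depends continuously on the initial function. -/
theorem exists_energy_bound (hK : 1 ≤ K) {d : ℕ} {A : Fin (K + 1) → Matrix (Fin n) (Fin n) ℝ}
    {P : Matrix (Fin n) (Fin n) ℝ} (hP : P.IsSymm) {η : ℝ}
    {Q S : Fin K → ℝ → Matrix (Fin n) (Fin n) ℝ}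
    {R : Fin K → Fin K → ℝ → ℝ → Matrix (Fin n) (Fin n) ℝ}
    (h1 : lyapM τ P η Q S ∈ G1 τ d) (h2 : R ∈ G2 τ d)
    (h3 : -lyapD τ A P η Q S R ∈ G3 τ d) (h4 : lyapL τ R ∈ G2 τ d) :
    ∃ V₀ : (ℝ → EuclideanSpace ℝ (Fin n)) → ℝ, V₀ 0 = 0 ∧
      (∀ X Y : ℝ → EuclideanSpace ℝ (Fin n), (∀ θ ∈ Icc (-τ.last) 0, X θ = Y θ) → V₀ X = V₀ Y) ∧
      (∀ Y : State τ.last n → ℝ → EuclideanSpace ℝ (Fin n),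
        (Continuous fun q : State τ.last n × ℝ => Y q.1 q.2) → Continuous fun φ => V₀ (Y φ)) ∧
      ∀ X : ℝ → EuclideanSpace ℝ (Fin n), Continuous X →
        (∀ t, 0 < t → HasDerivAt X (∑ k, Matrix.toEuclideanLin (A k) (X (t + -τ.val k))) t) →
        ∀ t, 0 ≤ t → η * ‖X t‖ ^ 2 + η * ∫ s in (0 : ℝ)..t, ‖X s‖ ^ 2 ≤ V₀ X := by
  obtain ⟨F, G, p, U, hF, hG, hp, hV⟩ := exists_lyapV hK hP h1 h2 h3 h4
  refine ⟨fun X => lyapV τ P F G p U (fun t => (X t).ofLp) 0, ?_, fun X Y h => ?_, fun Y hY => ?_,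
    fun X hX hd t ht => ?_⟩
  · have e1 : windowVec τ F (fun _ => (0 : Fin n → ℝ)) 0 = 0 := by
      ext a
      simp [windowVec, pieceIntegral]
    have e2 : moment τ p (fun _ => (0 : Fin n → ℝ)) 0 = 0 := by
      ext a
      simp [moment]
    simp [lyapV, e1, e2, windowQuad, pieceIntegral]
  · exact lyapV_congr _ _ _ _ _ fun θ hθ => by rw [h θ hθ]
  · exact continuous_lyapV P U hF hG hp ((PiLp.continuous_ofLp 2 _).comp hY)
  · have hx : Continuous fun t => (X t).ofLp := (PiLp.continuous_ofLp 2 _).comp hX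
    have hn : ∀ t, (X t).ofLp ⬝ᵥ (X t).ofLp = ‖X t‖ ^ 2 := fun t => by
      rw [EuclideanSpace.real_norm_sq_eq]
      simp [dotProduct, sq]
    obtain ⟨hpos, hdec⟩ := hV _ hx
    -- V at time t is the time-0 functional of the trajectory shifted by t, so continuity in the
    -- parameter t applies.
    have hVc : Continuous (lyapV τ P F G p U fun t => (X t).ofLp) := by
      rw [funext (lyapV_shift P F G p U _)]
      exact continuous_lyapV P U hF hG hp (by fun_prop)
    have := add_integral_le_of_deriv_le (f := fun s => η * ‖X s‖ ^ 2) hVc (by fun_prop)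
      (fun t ht => by
        simp only [← hn]
        refine hdec t ?_
        have := (PiLp.continuousLinearEquiv 2 ℝ
          (fun _ : Fin n => ℝ)).toContinuousLinearMap.hasFDerivAt.comp_hasDerivAt t (hd t ht)
        refine this.congr_deriv ?_
        rw [map_sum]
        rfl) ht
    have hp := hpos t
    rw [hn] at hp
    rw [intervalIntegral.integral_const_mul] at this
    linarith

/-- Square integrable solutions of a linear delay equation tend to zero. -/
theorem tendsto_zero_of_integral_sq_le {E : Type*} [NormedAddCommGroup E] [InnerProductSpace ℝ E]
    {ι : Type*} [Fintype ι] (B : ι → E →L[ℝ] E) {r : ι → ℝ} {ρ : ℝ} (hρ : 0 ≤ ρ)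
    (hr : ∀ k, r k ≤ ρ) {X : ℝ → E} (hX : Continuous X)
    (hd : ∀ t, 0 < t → HasDerivAt X (∑ k, B k (X (t + -r k))) t) {I : ℝ}
    (hI : ∀ t, 0 ≤ t → ∫ s in (0 : ℝ)..t, ‖X s‖ ^ 2 ≤ I) : Tendsto X atTop (𝓝 0) := by
  have hi : MeasureTheory.IntegrableOn (fun s => ‖X s‖ ^ 2) (Ioi 0) := by
    refine MeasureTheory.integrableOn_Ioi_of_intervalIntegral_norm_bounded (b := id) I 0
      (fun i => (Continuous.integrableOn_Ioc (by fun_prop))) tendsto_id ?_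
    filter_upwards [eventually_ge_atTop 0] with t ht
    simpa using hI t ht
  -- Starting at `ρ` keeps every delayed argument positive, inside the range where ‖X‖² is known to
  -- be integrable.
  have his : ∀ k, MeasureTheory.IntegrableOn (fun s => ‖X (s + -r k)‖ ^ 2) (Ioi ρ) := fun k => by
    have := (MeasureTheory.measurePreserving_add_right MeasureTheory.volume
      (-r k)).integrableOn_comp_preimage (measurableEmbedding_addRight (-r k))
      (f := fun s => ‖X s‖ ^ 2) (s := Ioi 0)
    refine (this.2 hi).mono_set fun s hs => ?_
    simp only [mem_preimage, mem_Ioi] at hs ⊢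
    linarith [hr k]
  have key : Tendsto (fun t => ‖X t‖ ^ 2) atTop (𝓝 0) := by
    refine MeasureTheory.tendsto_zero_of_hasDerivAt_of_integrableOn_Ioi (a := ρ)
      (f' := fun t => 2 * inner ℝ (X t) (∑ k, B k (X (t + -r k))))
      (fun t ht => (hd t (hρ.trans_lt ht)).norm_sq) ?_ (hi.mono_set (Ioi_subset_Ioi hρ))
    refine MeasureTheory.Integrable.mono'
      (g := fun t => ∑ k, ‖B k‖ * (‖X t‖ ^ 2 + ‖X (t + -r k)‖ ^ 2)) ?_
      (Continuous.aestronglyMeasurable (by fun_prop)) (Eventually.of_forall fun t => ?_)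
    · exact MeasureTheory.integrable_finsetSum _ fun k _ =>
        ((hi.mono_set (Ioi_subset_Ioi hρ)).add (his k)).const_mul _
    · rw [inner_sum, Finset.mul_sum]
      refine norm_sum_le_of_le _ fun k _ => ?_
      have e1 : |inner ℝ (X t) (B k (X (t + -r k)))| ≤ ‖X t‖ * (‖B k‖ * ‖X (t + -r k)‖) :=
        (abs_real_inner_le_norm _ _).trans (by gcongr; exact (B k).le_opNorm _)
      -- This is 2ab ≤ a² + b², which bounds the derivative of ‖X‖² by integrable functions.
      have e2 := mul_nonneg (norm_nonneg (B k)) (sq_nonneg (‖X t‖ - ‖X (t + -r k)‖))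
      rw [Real.norm_eq_abs, abs_mul, abs_two]
      linarith
  rw [tendsto_zero_iff_norm_tendsto_zero]
  have := key.sqrt
  simpa [Real.sqrt_sq] using this

/-- Solutions of the linear equation in terms of their extension to the real line. -/
theorem isSolution_iff (A : Fin (K + 1) → Matrix (Fin n) (Fin n) ℝ) (φ : State τ.last n)
    (x : Trajectory τ.last n) :
    IsSolution (delayFunctional τ A) φ x ↔
      (∀ (θ : ℝ) (hθ : θ ∈ Icc (-τ.last) (0 : ℝ)),
        IciExtend (x : Ici (-τ.last) → EuclideanSpace ℝ (Fin n)) θ = φ ⟨θ, hθ⟩) ∧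
      ∀ t, 0 ≤ t → HasDerivWithinAt (IciExtend (x : Ici (-τ.last) → EuclideanSpace ℝ (Fin n)))
        (∑ k, Matrix.toEuclideanLin (A k) (IciExtend (x : Ici (-τ.last) → _) (t + -τ.val k)))
        (Ici 0) t := by
  refine and_congr (forall₂_congr fun θ hθ => ?_) ?_
  · rw [IciExtend_of_mem _ (show θ ∈ Ici (-τ.last) from hθ.1)]
  · rw [NNReal.forall]
    refine forall₂_congr fun t ht => ?_
    have : delayFunctional τ A (segment x ⟨t, ht⟩) =
        ∑ k, Matrix.toEuclideanLin (A k) (IciExtend (x : Ici (-τ.last) → _) (t + -τ.val k)) := by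
      refine Finset.sum_congr rfl fun k _ => ?_
      rw [IciExtend_of_mem _ (show t + -τ.val k ∈ Ici (-τ.last) from
        by simp only [mem_Ici]; linarith [(τ.neg_mem k).1])]
      rfl
    change HasDerivWithinAt _ (delayFunctional τ A (segment x ⟨t, ht⟩)) _ t ↔ _
    rw [this]

theorem continuous_iciExtend {r : ℝ} (x : Trajectory r n) :
    Continuous (IciExtend (x : Ici (-r) → EuclideanSpace ℝ (Fin n))) :=
  x.continuous.comp ((continuous_const.max continuous_id).subtype_mk _)

theorem exists_isSolution (hK : 1 ≤ K) (A : Fin (K + 1) → Matrix (Fin n) (Fin n) ℝ)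
    (φ : State τ.last n) : ∃ x, IsSolution (delayFunctional τ A) φ x := by
  have hτ := τ.last_pos hK
  have h0 : -τ.last ≤ 0 := by linarith
  -- Extending φ by its end values keeps it bounded and makes it constant for t ≥ 0, as the
  -- existence result requires.
  let Φ : BoundedContinuousFunction ℝ (EuclideanSpace ℝ (Fin n)) :=
    BoundedContinuousFunction.ofNormedAddCommGroup (IccExtend h0 φ) (by fun_prop) ‖φ‖
      fun t => φ.norm_coe_le_norm _
  obtain ⟨X, hX, hX0, hd⟩ := exists_delay_solution
    (fun k => LinearMap.toContinuousLinearMap (Matrix.toEuclideanLin (A k)))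
    (r := τ.val) (fun k => by linarith [(τ.neg_mem k).2]) Φ
    (fun t ht => (IccExtend_of_right_le h0 φ ht).trans (IccExtend_of_right_le h0 φ le_rfl).symm)
  let x : Trajectory τ.last n := ⟨fun t => X t, by fun_prop⟩
  have hx : ∀ t, -τ.last ≤ t → IciExtend (x : Ici (-τ.last) → _) t = X t := fun t ht =>
    IciExtend_of_mem _ ht
  refine ⟨x, (isSolution_iff A φ x).2 ⟨fun θ hθ => ?_, fun t ht => ?_⟩⟩
  · rw [hx θ hθ.1, hX0 θ hθ.2]
    exact IccExtend_of_mem h0 φ hθ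
  · have e : ∑ k, Matrix.toEuclideanLin (A k) (IciExtend (x : Ici (-τ.last) → _) (t + -τ.val k)) =
        ∑ k, Matrix.toEuclideanLin (A k) (X (t + -τ.val k)) :=
      Finset.sum_congr rfl fun k _ => by rw [hx _ (by linarith [(τ.neg_mem k).1])]
    rw [e]
    exact (hd t ht).congr (fun s hs => hx s (h0.trans hs)) (hx t (h0.trans ht))

end Stability

end TimeDelay

theorem mainTheorem4 {K n : ℕ} (hK : 1 ≤ K) (τ : TimeDelay.Delays K)
    (A : Fin (K + 1) → Matrix (Fin n) (Fin n) ℝ) (d : ℕ)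
    (P : Matrix (Fin n) (Fin n) ℝ) (hP : P.IsSymm) (η : ℝ) (hη : 0 < η)
    (Q : Fin K → ℝ → Matrix (Fin n) (Fin n) ℝ) (hQ : ∀ i, Continuous (Q i))
    (S : Fin K → ℝ → Matrix (Fin n) (Fin n) ℝ) (hS : ∀ i, Continuous (S i))
    (hS' : ∀ i θ, (S i θ).IsSymm)
    (R : Fin K → Fin K → ℝ → ℝ → Matrix (Fin n) (Fin n) ℝ)
    (hR : ∀ i j, Continuous (fun p : ℝ × ℝ => R i j p.1 p.2))
    (hR' : ∀ i j θ ω, R i j θ ω = (R j i ω θ).transpose)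
    (h1 : TimeDelay.lyapM τ P η Q S ∈ TimeDelay.G1 τ d)
    (h2 : R ∈ TimeDelay.G2 τ d)
    (h3 : -TimeDelay.lyapD τ A P η Q S R ∈ TimeDelay.G3 τ d)
    (h4 : TimeDelay.lyapL τ R ∈ TimeDelay.G2 τ d) :
    ∃ G : TimeDelay.State τ.last n → TimeDelay.Trajectory τ.last n,
      TimeDelay.IsSolutionMap (TimeDelay.delayFunctional τ A) G ∧
      TimeDelay.IsAsymptoticallyStableOn G Set.univ := by
  open TimeDelay in
  obtain ⟨V₀, hV0, hVcongr, hVcont, hV⟩ := exists_energy_bound hK hP h1 h2 h3 h4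
  choose G hG using exists_isSolution (τ := τ) hK A
  have hder : ∀ {X : ℝ → EuclideanSpace ℝ (Fin n)} {t : ℝ} {v}, 0 < t →
      HasDerivWithinAt X v (Ici 0) t → HasDerivAt X v t := fun ht h =>
    h.hasDerivAt (Ici_mem_nhds ht)
  have h0 : -τ.last ≤ 0 := by linarith [τ.last_pos hK]
  have huniq : ∀ φ x y, IsSolution (delayFunctional τ A) φ x →
      IsSolution (delayFunctional τ A) φ y → x = y := by
    intro φ x y hx hy
    rw [isSolution_iff] at hx hy
    -- By linearity the difference solves the same equation with zero initial segment, so its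
    -- initial energy is zero and the bound forces it to vanish.
    have hxy := hV (fun t => IciExtend (x : Ici (-τ.last) → EuclideanSpace ℝ (Fin n)) t -
      IciExtend (y : Ici (-τ.last) → EuclideanSpace ℝ (Fin n)) t)
      ((continuous_iciExtend x).sub (continuous_iciExtend y)) fun t ht => by
        simp only [map_sub, Finset.sum_sub_distrib]
        exact (hder ht (hx.2 t ht.le)).sub (hder ht (hy.2 t ht.le))
    rw [hVcongr _ 0 fun θ hθ => by rw [hx.1 θ hθ, hy.1 θ hθ, sub_self, Pi.zero_apply], hV0] at hxy
    ext1 t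
    rw [← IciExtend_coe x t, ← IciExtend_coe y t]
    rcases le_total (t : ℝ) 0 with ht | ht
    · rw [hx.1 t ⟨t.2, ht⟩, hy.1 t ⟨t.2, ht⟩]
    · have h := hxy t ht
      have hint : 0 ≤ η * ∫ s in (0 : ℝ)..t, ‖IciExtend (x : Ici (-τ.last) → _) s -
          IciExtend (y : Ici (-τ.last) → EuclideanSpace ℝ (Fin n)) s‖ ^ 2 :=
        mul_nonneg hη.le (intervalIntegral.integral_nonneg ht fun s _ => sq_nonneg _)
      have hsq : ‖IciExtend (x : Ici (-τ.last) → _) t -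
          IciExtend (y : Ici (-τ.last) → EuclideanSpace ℝ (Fin n)) t‖ ^ 2 ≤ 0 :=
        le_of_mul_le_mul_left (by linarith) hη
      exact sub_eq_zero.1 (norm_eq_zero.1 (pow_eq_zero_iff two_ne_zero |>.1
        (le_antisymm hsq (sq_nonneg _))))
  have hG' := fun φ => (isSolution_iff A φ (G φ)).1 (hG φ)
  -- The trajectory and the constant extension of φ agree on [-τ, 0], so the initial energy is a
  -- function of φ alone.
  have hVφ : ∀ φ, V₀ (IciExtend (G φ)) = V₀ (IccExtend h0 φ) := fun φ =>
    hVcongr _ _ fun θ hθ => by rw [(hG' φ).1 θ hθ, IccExtend_of_mem h0 φ hθ]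
  have henergy : ∀ φ t, 0 ≤ t → η * ‖IciExtend (G φ) t‖ ^ 2 +
      η * ∫ s in (0 : ℝ)..t, ‖IciExtend (G φ) s‖ ^ 2 ≤ V₀ (IccExtend h0 φ) := fun φ => by
    rw [← hVφ]
    exact hV _ (continuous_iciExtend _) fun t ht => hder ht ((hG' φ).2 t ht.le)
  have hbound : ∀ φ t, 0 ≤ t → η * ‖IciExtend (G φ) t‖ ^ 2 ≤ V₀ (IccExtend h0 φ) := by
    intro φ t ht
    have := mul_nonneg hη.le (intervalIntegral.integral_nonneg (μ := MeasureTheory.volume) ht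
      fun s _ => sq_nonneg ‖IciExtend (G φ) s‖)
    linarith [henergy φ t ht]
  have hinit : ∀ φ (t : Ici (-τ.last)), (t : ℝ) ≤ 0 → ‖G φ t‖ ≤ ‖φ‖ := fun φ t ht => by
    rw [(hG φ).1 t ⟨t.2, ht⟩]
    exact φ.norm_coe_le_norm _
  -- The `+ 1` in the bound avoids a square root: a² ≤ c implies a ≤ c + 1. The summand `‖φ‖` covers
  -- t ≤ 0.
  refine ⟨G, fun φ x => ⟨fun hx => huniq φ x _ hx (hG φ), fun hx => hx ▸ hG φ⟩,
    ⟨fun φ _ => ⟨‖φ‖ + (V₀ (IccExtend h0 φ) / η + 1), fun t => ?_⟩, fun ε hε => ?_⟩, fun φ _ => ?_⟩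
  · rcases le_total (t : ℝ) 0 with ht | ht
    · have := hbound φ 0 le_rfl
      have hq : 0 ≤ V₀ (IccExtend h0 φ) / η := div_nonneg (this.trans' (by positivity)) hη.le
      linarith [hinit φ t ht]
    · have := hbound φ t ht
      rw [IciExtend_coe, mul_comm, ← le_div_iff₀ hη] at this
      nlinarith [norm_nonneg φ, sq_nonneg (‖G φ t‖ - 1)]
  · have hc : Continuous fun φ : State τ.last n => V₀ (IccExtend h0 φ) :=
      hVcont (fun φ => IccExtend h0 φ) (by
        change Continuous fun q : State τ.last n × ℝ => q.1 (projIcc _ _ h0 q.2)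
        fun_prop)
    have hz : V₀ (IccExtend h0 (0 : State τ.last n)) = 0 := hV0
    have hlim : ∀ᶠ φ : State τ.last n in 𝓝 0, V₀ (IccExtend h0 φ) < η * ε ^ 2 :=
      (hc.tendsto' 0 0 hz).eventually_lt_const (by positivity)
    obtain ⟨δ, hδ, hball⟩ := Metric.eventually_nhds_iff.1 hlim
    -- Here `δ` controls t ≥ 0 through the energy, while `ε` handles t ≤ 0, where the solution is φ
    -- itself.
    refine ⟨min δ ε, lt_min hδ hε, fun φ hφ t => ?_⟩
    rcases le_total (t : ℝ) 0 with ht | ht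
    · exact (hinit φ t ht).trans_lt (hφ.trans_le (min_le_right _ _))
    · have h := (hbound φ t ht).trans_lt
        (hball (by rw [dist_zero_right]; exact hφ.trans_le (min_le_left _ _)))
      rw [IciExtend_coe] at h
      exact lt_of_pow_lt_pow_left₀ 2 hε.le (lt_of_mul_lt_mul_left h hη.le)
  · refine tendsto_zero_of_integral_sq_le
      (fun k => LinearMap.toContinuousLinearMap (Matrix.toEuclideanLin (A k)))
      (τ.last_pos hK).le (fun k => by linarith [(τ.neg_mem k).1]) (continuous_iciExtend _)
      (fun t ht => hder ht ((hG' φ).2 t ht.le)) (I := V₀ (IccExtend h0 φ) / η) fun t ht => ?_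
    rw [le_div_iff₀ hη, mul_comm]
    linarith [henergy φ t ht, mul_nonneg hη.le (sq_nonneg ‖IciExtend (G φ) t‖)]
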